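/- Let $n\ge 0$. A \emph{planar network} of rank $n$ is a finite graph embedded in a strip $0\le x\le r$, $1\le y\le n$ ($r>0$), whose edges are never vertical (each edge is the graph of a continuous function over an interval of the $x$-axis) and are oriented from left to right, with exactly $n$ vertices on the line $x=0$ (the sources) and exactly $n$ vertices on the line $x=r$ (the sinks), both numbered from bottom to top. The concatenation $\Pi\circ\Pi'$ is obtained by gluing the $i$-th sink of $\Pi$ to the $i$-th source of $\Pi'$ for all $i$. An $a$-\emph{multipath} in a network is a collection of $a$ pairwise vertex-disjoint oriented paths, each going from a source to a sink. Let $\mathbb T=\mathbb R\cup\{-\infty\}$, let $\Pi_1,\Pi_2,\Pi_3$ be planar networks of rank $n$, and let $w_1,w_2,w_3$ be arbitrary $\mathbb T$-valued weightings of their edges. The weight of a multipath is the sum of the weights of its edges. Let $\Delta^3(n)=\{(a,b,c)\in\mathbb Z_{\ge0}^3 : a+b+c\le n\}$, and for $(a,b,c)\in\Delta^3(n)$ let $m_{a,b,c}\in\mathbb T$ be the maximum, over all triples $(p_1,p_2,p_3)$ of pairwise vertex-disjoint multipaths, with $p_1$ an $a$-multipath in $\Pi_1$, $p_2$ a $b$-multipath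 in $\Pi_1\circ\Pi_2$ and $p_3$ a $c$-multipath in $\Pi_1\circ\Pi_2\circ\Pi_3$, of the sum of the weights of $p_1,p_2,p_3$ (and $-\infty$ if there is no such triple). Consider any small tetrahedron in $\Delta^3(n)$, with vertices $(i,j,k)$, $(i+2,j,k)$, $(i,j+2,k)$, $(i,j,k+2)$, where $i,j,k\ge 0$ and $i+j+k+2\le n$, and denote the values of $m$ at the midpoints of its three pairs of opposite edges by $$a_1=m_{i,j+1,k},\ a_2=m_{i+1,j,k+1},\qquad b_1=m_{i+1,j,k},\ b_2=m_{i,j+1,k+1},\qquad c_1=m_{i,j,k+1},\ c_2=m_{i+1,j+1,k}.$$ Then each of the three sums is at most the maximum of the other two: $$a_1+a_2\le\max\{b_1+b_2,c_1+c_2\},\quad b_1+b_2\le\max\{a_1+a_2,c_1+c_2\},\quad c_1+c_2\le\max\{a_1+a_2,b_1+b_2\}.$$ In particular $m$ lies in the non-smooth locus of $\max\{a_1+a_2,\,b_1+b_2,\,c_1+c_2\}$: if the six values are real, then this function, regarded as a function on $\mathbb R^{\Delta^3(n)}$, is not differentiable at any point whose coordinates at the six midpoints are the values of $m$. -/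

import Mathlib

/-- The tropical numbers `ℝ ∪ {-∞}`, with `max` as tropical sum and `+` as tropical product. -/
abbrev TropNum : Type := WithBot ℝ

/-- A finite directed multigraph with `n` marked sources and `n` marked sinks. -/
structure Network (n : ℕ) where
  V : Type
  E : Type
  finV : Finite V
  finE : Finite E
  src : E → V
  tgt : E → V
  source : Fin n → V
  sink : Fin n → V

attribute [instance] Network.finV Network.finE

/-- A planar network of rank `n`: a finite graph embedded in the strip `0 ≤ x ≤ r`, `1 ≤ y ≤ n`.
Edges are never vertical: the edge `e` is the graph of a continuous function `curve e` over the
interval between the abscissas of its ends, and it is oriented from left to right.  The vertices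
on the line `x = 0` are the `n` sources, those on the line `x = r` are the `n` sinks, both
enumerated from bottom to top. -/
structure PlanarNetwork (n : ℕ) extends Network n where
  r : ℝ
  r_pos : 0 < r
  x : V → ℝ
  y : V → ℝ
  curve : E → ℝ → ℝ
  x_mem : ∀ v, x v ∈ Set.Icc 0 r
  y_mem : ∀ v, y v ∈ Set.Icc (1 : ℝ) n
  /-- distinct vertices are distinct points -/
  vertex_inj : ∀ u v, x u = x v → y u = y v → u = v
  left_to_right : ∀ e, x (src e) < x (tgt e)
  curve_continuous : ∀ e, ContinuousOn (curve e) (Set.Icc (x (src e)) (x (tgt e)))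
  curve_mem : ∀ e, ∀ t ∈ Set.Icc (x (src e)) (x (tgt e)), curve e t ∈ Set.Icc (1 : ℝ) n
  curve_src : ∀ e, curve e (x (src e)) = y (src e)
  curve_tgt : ∀ e, curve e (x (tgt e)) = y (tgt e)
  /-- no vertex lies in the interior of an edge -/
  vertex_not_mem : ∀ e v, x v ∈ Set.Ioo (x (src e)) (x (tgt e)) → curve e (x v) ≠ y v
  /-- the interiors of distinct edges do not meet -/
  edge_disjoint : ∀ e f, e ≠ f → ∀ t ∈ Set.Ioo (x (src e)) (x (tgt e)),
    t ∈ Set.Ioo (x (src f)) (x (tgt f)) → curve e t ≠ curve f t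
  source_iff : ∀ v, x v = 0 ↔ v ∈ Set.range source
  sink_iff : ∀ v, x v = r ↔ v ∈ Set.range sink
  source_mono : StrictMono fun i => y (source i)
  sink_mono : StrictMono fun i => y (sink i)

namespace Network

variable {n : ℕ}

/-- `l` is the list of edges of an oriented path from the `i`-th source to the `j`-th sink. -/
structure IsPath (N : Network n) (l : List N.E) (i j : Fin n) : Prop where
  chain : l.IsChain fun e f => N.tgt e = N.src f
  first : ∃ e ∈ l.head?, N.src e = N.source i
  last : ∃ e ∈ l.getLast?, N.tgt e = N.sink j
  nodup : (N.source i :: l.map N.tgt).Nodup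

/-- The oriented paths from a source to a sink. -/
def Path (N : Network n) : Type := {l : List N.E // ∃ i j, N.IsPath l i j}

/-- The vertices of a path. -/
def Path.verts {N : Network n} (p : N.Path) : Set N.V :=
  {v | ∃ e ∈ p.1, v = N.src e ∨ v = N.tgt e}

def Path.weight {N : Network n} (w : N.E → TropNum) (p : N.Path) : TropNum :=
  (p.1.map w).sum

instance (N : Network n) : Finite N.Path := by
  classical
  have : Fintype N.E := Fintype.ofFinite _
  refine Finite.of_injective
    (fun p : N.Path => (⟨p.1, ?_⟩ : {l : List N.E // l.Nodup})) ?_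
  · obtain ⟨i, j, h⟩ := p.2
    exact List.Nodup.of_map _ (List.nodup_cons.1 h.nodup).2
  · intro p q h
    exact Subtype.ext (by simpa using h)

/-- An `a`-multipath: a collection of `a` pairwise non-intersecting paths from sources to sinks. -/
def Multipath (N : Network n) (a : ℕ) : Type :=
  {P : Finset N.Path // P.card = a ∧
    ∀ p ∈ P, ∀ q ∈ P, p ≠ q → Disjoint p.verts q.verts}

instance (N : Network n) (a : ℕ) : Finite (N.Multipath a) :=
  inferInstanceAs (Finite {P : Finset N.Path // P.card = a ∧
    ∀ p ∈ P, ∀ q ∈ P, p ≠ q → Disjoint p.verts q.verts})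

def Multipath.verts {N : Network n} {a : ℕ} (P : N.Multipath a) : Set N.V :=
  {v | ∃ p ∈ P.1, v ∈ p.verts}

/-- The tropical product (that is, the sum) of the weights of all edges of the multipath. -/
noncomputable def Multipath.weight {N : Network n} (w : N.E → TropNum) {a : ℕ}
    (P : N.Multipath a) : TropNum :=
  ∑ p ∈ P.1, p.weight w

/-- The vertices of the concatenation: those of `N`, and those of `M` that are not sources. -/
abbrev ConcatV (N M : Network n) : Type := N.V ⊕ {v : M.V // v ∉ Set.range M.source}

open Classical in
/-- The map from the vertices of `M` to those of the concatenation; it sends the `i`-th source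
of `M` to the `i`-th sink of `N`. -/
noncomputable def concatRight (N M : Network n) (v : M.V) : ConcatV N M :=
  if h : v ∈ Set.range M.source then Sum.inl (N.sink h.choose) else Sum.inr ⟨v, h⟩

/-- The concatenation `N ∘ M`: the `i`-th sink of `N` is glued to the `i`-th source of `M`. -/
noncomputable def concat (N M : Network n) : Network n where
  V := ConcatV N M
  E := N.E ⊕ M.E
  finV := inferInstance
  finE := inferInstance
  src := Sum.elim (fun e => Sum.inl (N.src e)) fun e => concatRight N M (M.src e)
  tgt := Sum.elim (fun e => Sum.inl (N.tgt e)) fun e => concatRight N M (M.tgt e)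
  source := fun i => Sum.inl (N.source i)
  sink := fun i => concatRight N M (M.sink i)

/-- The inclusion of the vertices of `N` into those of `N ∘ M`. -/
def inclLeft (N M : Network n) : N.V → (N.concat M).V := Sum.inl

/-- The weighting of the concatenation given by weightings of the factors. -/
def concatWeight {N M : Network n} (w : N.E → TropNum) (u : M.E → TropNum) :
    (N.concat M).E → TropNum :=
  Sum.elim w u

/-- An `(a, b, c)`-multipath in `A ∘ B ∘ C`: an `a`-multipath in `A`, a `b`-multipath in `A ∘ B`
and a `c`-multipath in `A ∘ B ∘ C` that are pairwise non-intersecting in `A ∘ B ∘ C`. -/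
structure MultiMultipath (A B C : Network n) (a b c : ℕ) where
  p₁ : A.Multipath a
  p₂ : (A.concat B).Multipath b
  p₃ : ((A.concat B).concat C).Multipath c
  disj₁₂ : Disjoint (A.inclLeft B '' p₁.verts) p₂.verts
  disj₁₃ : Disjoint ((A.concat B).inclLeft C '' (A.inclLeft B '' p₁.verts)) p₃.verts
  disj₂₃ : Disjoint ((A.concat B).inclLeft C '' p₂.verts) p₃.verts

instance (A B C : Network n) (a b c : ℕ) : Finite (MultiMultipath A B C a b c) := by
  refine Finite.of_injective
    (fun P : MultiMultipath A B C a b c => (P.p₁, P.p₂, P.p₃)) ?_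
  rintro ⟨p₁, p₂, p₃, _, _, _⟩ ⟨q₁, q₂, q₃, _, _, _⟩ h
  simp only [Prod.mk.injEq] at h
  obtain ⟨rfl, rfl, rfl⟩ := h
  rfl

noncomputable instance (A B C : Network n) (a b c : ℕ) :
    Fintype (MultiMultipath A B C a b c) :=
  Fintype.ofFinite _

noncomputable def MultiMultipath.weight {A B C : Network n} (w₁ : A.E → TropNum)
    (w₂ : B.E → TropNum) (w₃ : C.E → TropNum) {a b c : ℕ}
    (P : MultiMultipath A B C a b c) : TropNum :=
  P.p₁.weight w₁ + P.p₂.weight (concatWeight w₁ w₂) +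
    P.p₃.weight (concatWeight (concatWeight w₁ w₂) w₃)

end Network

/-- The lattice points of the simplex `x₁, x₂, x₃ ≥ 0`, `x₁ + x₂ + x₃ ≤ n`. -/
def latticeSimplex (n : ℕ) : Finset (ℕ × ℕ × ℕ) :=
  (Finset.range (n + 1) ×ˢ Finset.range (n + 1) ×ˢ Finset.range (n + 1)).filter
    fun a => a.1 + a.2.1 + a.2.2 ≤ n

theorem mem_latticeSimplex {n a b c : ℕ} (h : a + b + c ≤ n) : (a, b, c) ∈ latticeSimplex n := by
  simp only [latticeSimplex, Finset.mem_filter, Finset.mem_product, Finset.mem_range]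
  omega

/-- The map `m` from triples of weightings to tropical functions on the lattice simplex: the value
at `(a, b, c)` is the maximal weight of an `(a, b, c)`-multipath, `-∞` if there is none. -/
noncomputable def maxWeight {n : ℕ} (A B C : PlanarNetwork n) (w₁ : A.E → TropNum)
    (w₂ : B.E → TropNum) (w₃ : C.E → TropNum) : latticeSimplex n → TropNum :=
  fun α => Finset.univ.sup fun P : Network.MultiMultipath A.toNetwork B.toNetwork C.toNetwork
    α.1.1 α.1.2.1 α.1.2.2 => P.weight w₁ w₂ w₃

/-- A small tetrahedron, with vertices `(i, j, k)`, `(i + 2, j, k)`, `(i, j + 2, k)`,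
`(i, j, k + 2)`, all in the lattice simplex. -/
structure SmallTetrahedron (n : ℕ) where
  i : ℕ
  j : ℕ
  k : ℕ
  le : i + j + k + 2 ≤ n

namespace SmallTetrahedron

variable {n : ℕ} (T : SmallTetrahedron n)

/-! The midpoints of the six edges; `a₁, a₂` and `b₁, b₂` and `c₁, c₂` are on opposite edges. -/

def a₁ : latticeSimplex n :=
  ⟨(T.i, T.j + 1, T.k), mem_latticeSimplex (by have := T.le; omega)⟩

def a₂ : latticeSimplex n :=
  ⟨(T.i + 1, T.j, T.k + 1), mem_latticeSimplex (by have := T.le; omega)⟩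

def b₁ : latticeSimplex n :=
  ⟨(T.i + 1, T.j, T.k), mem_latticeSimplex (by have := T.le; omega)⟩

def b₂ : latticeSimplex n :=
  ⟨(T.i, T.j + 1, T.k + 1), mem_latticeSimplex (by have := T.le; omega)⟩

def c₁ : latticeSimplex n :=
  ⟨(T.i, T.j, T.k + 1), mem_latticeSimplex (by have := T.le; omega)⟩

def c₂ : latticeSimplex n :=
  ⟨(T.i + 1, T.j + 1, T.k), mem_latticeSimplex (by have := T.le; omega)⟩

/-- The function `max {a₁ + a₂, b₁ + b₂, c₁ + c₂}` on real functions on the lattice simplex. -/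
def maxFun (z : latticeSimplex n → ℝ) : ℝ :=
  max (z T.a₁ + z T.a₂) (max (z T.b₁ + z T.b₂) (z T.c₁ + z T.c₂))

end SmallTetrahedron

/-! The mechanism is an exchange of alternating paths. Let `G` be the concatenation of the three
networks. No edge of `G` enters one of its left parts `A`, `A ∘ B` from outside, so a triple of
disjoint multipaths is the same as one family of vertex-disjoint paths in `G`, each allowed to stop
at a sink of any of the three left parts; the numbers of paths stopping at the three levels are `a`,
`b`, `c`. The abscissa makes `G` acyclic, so such a family is determined by its edge set, a linking.

A linking becomes a matching between two copies of the vertex set of `G`: an edge joins the left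
copy of its source to the right copy of its target, and every unvisited vertex is joined to its own
copy by a loop of weight 0. The uncovered left vertices are the ends of the paths, and the uncovered
right vertices are their starting points. Colour the vertices by level. Writing `t` for `(i, j, k)`,
each of the three inequalities starts from optimal matchings `M` and `N` whose uncovered left
vertices have colour counts `t + s` and `t + p + q`, where `p`, `q`, `s` are the three levels in
some order.

Interchanging `M` and `N` on a union of components of their superposition keeps the total multiset
of edges, hence the sum of the weights, including weights `-∞`. It remains to choose the components.
The ends of alternating paths are paired off by colour, apart from one point each of colours `p` and
`q` on one side and of colours `s` and right on the other. Tracing from the exceptional point of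
colour `p`, along alternating paths and across these pairs, one arrives at `s` or at the right point
(`exists_orbit_segment`, `exists_invariant_set`). The interchange on the traced set yields the
counts `t + p`, `t + q + s` in the first case and `t + p + s`, `t + q` in the second
(`exists_matching_exchange`, `exists_linking_exchange`). These are the two terms of the maximum.

If none of three real sums exceeds the maximum of the other two, the maximum is attained at least
twice, and moving one coordinate in one maximal sum shows a kink. -/

/-! ### Orbits of partial injections and coloured counting -/

/-- The orbit of a point outside the image of `Tᶜ`, followed until it first enters `T`. -/
theorem exists_orbit_segment {X : Type*} [Finite X] (f : X → X) (T : Set X) (x : X)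
    (hf : Set.InjOn f Tᶜ) (hx : ∀ u, u ∉ T → f u ≠ x) :
    ∃ Z : Set X, x ∈ Z ∧ (∀ u, u ∉ T → (u ∈ Z ↔ f u ∈ Z)) ∧
      (∃ y ∈ T, ∀ u ∈ T, u ∈ Z ↔ u = y) ∧
      ∀ u ∈ Z, u ≠ x → ∃ v, v ∉ T ∧ f v = u := by
  classical
  -- Otherwise all iterates are distinct: an equality between two of them cancels back, by
  -- injectivity off `T`, to an iterate that returns to `x`, which is not a value of `f` there. This
  -- contradicts finiteness.
  have hit : ∃ k, f^[k] x ∈ T := by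
    by_contra! h
    have key : ∀ i d, f^[i] x ≠ f^[i + d + 1] x := by
      intro i
      induction i with
      | zero =>
        intro d hd
        rw [zero_add, Function.iterate_succ_apply'] at hd
        exact hx _ (h d) hd.symm
      | succ i ih =>
        intro d hd
        rw [show i + 1 + d + 1 = (i + d + 1) + 1 by ring, Function.iterate_succ_apply',
          Function.iterate_succ_apply'] at hd
        exact ih d (hf (h _) (h _) hd)
    obtain ⟨i, j, hij, he⟩ := Finite.exists_ne_map_eq_of_infinite fun k : ℕ => f^[k] x
    rcases lt_or_gt_of_ne hij with hlt | hlt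
    · obtain ⟨d, rfl⟩ := Nat.exists_eq_add_of_lt hlt
      exact key _ _ he
    · obtain ⟨d, rfl⟩ := Nat.exists_eq_add_of_lt hlt
      exact key _ _ he.symm
  set k := Nat.find hit with hk
  have hkT : f^[k] x ∈ T := Nat.find_spec hit
  have hlt : ∀ j < k, f^[j] x ∉ T := fun j hj => Nat.find_min hit hj
  refine ⟨{u | ∃ j ≤ k, f^[j] x = u}, ⟨0, Nat.zero_le _, rfl⟩, ?_, ⟨_, hkT, ?_⟩, ?_⟩
  · intro u hu
    constructor
    · rintro ⟨j, hj, rfl⟩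
      have : j ≠ k := by rintro rfl; exact hu hkT
      exact ⟨j + 1, by omega, Function.iterate_succ_apply' _ _ _⟩
    · rintro ⟨j, hj, h⟩
      rcases j with _ | j
      · exact absurd h.symm (hx u hu)
      · rw [Function.iterate_succ_apply'] at h
        exact ⟨j, by omega, hf (hlt j (by omega)) hu h⟩
  · intro u hu
    constructor
    · rintro ⟨j, hj, rfl⟩
      by_cases hjk : j = k
      · rw [hjk]
      · exact absurd hu (hlt j (by omega))
    · rintro rfl
      exact ⟨k, le_rfl, rfl⟩
  · rintro u ⟨j, hj, rfl⟩ hne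
    rcases j with _ | j
    · exact absurd rfl hne
    · exact ⟨_, hlt j (by omega), (Function.iterate_succ_apply' _ _ _).symm⟩

/-- Two finite sets with equally large fibres are in a fibre-preserving bijection. -/
theorem exists_bijOn_of_card_fiber_eq {X C : Type*} [DecidableEq C] (κ : X → C)
    (D B : Finset X) (h : ∀ c, (D.filter (κ · = c)).card = (B.filter (κ · = c)).card) :
    ∃ g : X → X, Set.BijOn g D B ∧ ∀ x ∈ D, κ (g x) = κ x := by
  classical
  let e : ∀ c, (D.filter (κ · = c)) ≃ (B.filter (κ · = c)) := fun c => Finset.equivOfCardEq (h c)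
  let g : X → X := fun x => if hx : x ∈ D then
    (e (κ x) ⟨x, Finset.mem_filter.2 ⟨hx, rfl⟩⟩ : X) else x
  have hg : ∀ x (hx : x ∈ D), g x = (e (κ x) ⟨x, Finset.mem_filter.2 ⟨hx, rfl⟩⟩ : X) :=
    fun x hx => dif_pos hx
  have hmem : ∀ x ∈ D, g x ∈ B ∧ κ (g x) = κ x := fun x hx => by
    rw [hg x hx]
    exact Finset.mem_filter.1 (e (κ x) ⟨x, Finset.mem_filter.2 ⟨hx, rfl⟩⟩).2
  have hinv : ∀ c (y : D.filter (κ · = c)), g y = e c y := by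
    rintro c ⟨y, hy⟩
    obtain ⟨hyD, rfl⟩ := Finset.mem_filter.1 hy
    exact hg y hyD
  refine ⟨g, ⟨fun x hx => (hmem x hx).1, ?_, ?_⟩, fun x hx => (hmem x hx).2⟩
  · intro x hx y hy hxy
    have hκ : κ x = κ y := by rw [← (hmem x hx).2, ← (hmem y hy).2, hxy]
    have h1 := hinv (κ y) ⟨x, Finset.mem_filter.2 ⟨hx, hκ⟩⟩
    have h2 := hinv (κ y) ⟨y, Finset.mem_filter.2 ⟨hy, rfl⟩⟩
    have := (e (κ y)).injective (Subtype.ext (h1.symm.trans (hxy.trans h2)))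
    exact congrArg Subtype.val this
  · intro y hy
    have h1 := hinv (κ y) ((e (κ y)).symm ⟨y, Finset.mem_filter.2 ⟨hy, rfl⟩⟩)
    rw [Equiv.apply_symm_apply] at h1
    exact ⟨_, (Finset.mem_filter.1 ((e (κ y)).symm _).2).1, h1⟩

theorem card_filter_erase_erase {X C : Type*} [DecidableEq X] [DecidableEq C] (κ : X → C)
    (B Z : Finset X) (x y : X) (hx : x ∈ B) (hy : y ∈ B) (hxy : κ x ≠ κ y) (c : C) :
    (B.filter fun u => κ u = c ∧ u ∈ Z).card =
      (((B.erase x).erase y).filter fun u => κ u = c ∧ u ∈ Z).card +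
        ((if c = κ x ∧ x ∈ Z then 1 else 0) + if c = κ y ∧ y ∈ Z then 1 else 0) := by
  have hne : y ≠ x := fun h => hxy (by rw [h])
  have hy' : y ∈ B.erase x := Finset.mem_erase.2 ⟨hne, hy⟩
  conv_lhs => rw [← Finset.insert_erase hx, ← Finset.insert_erase hy']
  rw [Finset.filter_insert, Finset.filter_insert]
  have e1 : (κ x = c ∧ x ∈ Z) ↔ (c = κ x ∧ x ∈ Z) := by rw [eq_comm]
  have e2 : (κ y = c ∧ y ∈ Z) ↔ (c = κ y ∧ y ∈ Z) := by rw [eq_comm]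
  simp only [e1, e2]
  split_ifs with h1 h2 h2
  · exact absurd (h1.1.symm.trans h2.1) hxy
  · rw [Finset.card_insert_of_notMem (by simp [hne.symm])]
  · rw [Finset.card_insert_of_notMem (by simp)]
  · simp

/-- Let `f` map `Dᶜ` injectively to `Bᶜ`, where the points of `B` and `D` are coloured so that `B`
has one more point than `D` of colours `p` and `q`, and one fewer of colours `s` and `t`.  Some
set that is invariant under `f` has a surplus exactly at `p` and a deficit exactly at one of
`s` and `t`. -/
theorem exists_invariant_set {X C : Type*} [Fintype X] [DecidableEq X] [DecidableEq C]
    (f : X → X) (κ : X → C) (B D : Finset X) (hinj : Set.InjOn f (D : Set X)ᶜ)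
    (hmaps : ∀ u, u ∉ D → f u ∉ B) (p q s t : C) (hpq : p ≠ q) (hst : s ≠ t) (hps : p ≠ s)
    (hpt : p ≠ t) (hqs : q ≠ s) (hqt : q ≠ t)
    (hcard : ∀ c, (B.filter (κ · = c)).card +
        ((if c = s then 1 else 0) + if c = t then 1 else 0) =
      (D.filter (κ · = c)).card + ((if c = p then 1 else 0) + if c = q then 1 else 0)) :
    ∃ Z : Finset X, (∀ u, u ∉ D → (u ∈ Z ↔ f u ∈ Z)) ∧ ∃ y, (y = s ∨ y = t) ∧
      ∀ c, (B.filter fun u => κ u = c ∧ u ∈ Z).card + (if c = y then 1 else 0) =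
        (D.filter fun u => κ u = c ∧ u ∈ Z).card + (if c = p then 1 else 0) := by
  classical
  have exB : ∀ c, (c = p ∨ c = q) → ∃ x ∈ B, κ x = c := by
    intro c hc
    have h := hcard c
    have : 0 < (B.filter (κ · = c)).card := by
      rcases hc with rfl | rfl
      · simp [hps, hpt] at h; omega
      · simp [hqs, hqt] at h; omega
    obtain ⟨x, hx⟩ := Finset.card_pos.1 this
    exact ⟨x, Finset.mem_filter.1 hx⟩
  have exD : ∀ c, (c = s ∨ c = t) → ∃ x ∈ D, κ x = c := by
    intro c hc
    have h := hcard c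
    have : 0 < (D.filter (κ · = c)).card := by
      rcases hc with rfl | rfl
      · simp [hps.symm, hqs.symm] at h; omega
      · simp [hpt.symm, hqt.symm] at h; omega
    obtain ⟨x, hx⟩ := Finset.card_pos.1 this
    exact ⟨x, Finset.mem_filter.1 hx⟩
  obtain ⟨xp, hxpB, hxp⟩ := exB p (.inl rfl)
  obtain ⟨xq, hxqB, hxq⟩ := exB q (.inr rfl)
  obtain ⟨ys, hysD, hys⟩ := exD s (.inl rfl)
  obtain ⟨yt, hytD, hyt⟩ := exD t (.inr rfl)
  have cB := fun Z => card_filter_erase_erase κ B Z xp xq hxpB hxqB (by rwa [hxp, hxq])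
  have cD := fun Z => card_filter_erase_erase κ D Z ys yt hysD hytD (by rwa [hys, hyt])
  rw [hxp, hxq] at cB
  rw [hys, hyt] at cD
  set B' := (B.erase xp).erase xq with hB'
  set D' := (D.erase ys).erase yt with hD'
  -- With one point of each exceptional colour removed, `B` and `D` have equal colour counts, so `g`
  -- can send each remaining stopping point to a starting point of its colour.
  obtain ⟨g, ⟨hgm, hgi, hgs⟩, hgκ⟩ := exists_bijOn_of_card_fiber_eq κ D' B' (by
    intro c
    have h1 := cB Finset.univ c
    have h2 := cD Finset.univ c
    simp only [Finset.mem_univ, and_true] at h1 h2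
    have := hcard c
    omega)
  -- `F` restarts the walk wherever `f` stops, except at `ys` and `yt`; it is injective off these
  -- two and never takes the values `xp`, `xq` there.
  let F : X → X := fun u => if u ∈ D then g u else f u
  have hFD : ∀ u ∈ D, F u = g u := fun u hu => if_pos hu
  have hFn : ∀ u, u ∉ D → F u = f u := fun u hu => if_neg hu
  have hD'mem : ∀ u, u ∈ D' ↔ u ∈ D ∧ u ∉ ({ys, yt} : Set X) := by
    intro u
    simp only [hD', Finset.mem_erase, Set.mem_insert_iff, Set.mem_singleton_iff]
    tauto
  have hB'sub : ∀ u ∈ B', u ∈ B ∧ u ≠ xp ∧ u ≠ xq := by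
    intro u
    simp only [hB', Finset.mem_erase]
    tauto
  have hFne : ∀ u, u ∉ ({ys, yt} : Set X) → F u ≠ xp ∧ F u ≠ xq := by
    intro u hu
    by_cases huD : u ∈ D
    · rw [hFD u huD]
      exact (hB'sub _ (hgm ((hD'mem u).2 ⟨huD, hu⟩))).2
    · rw [hFn u huD]
      exact ⟨fun h => hmaps u huD (h ▸ hxpB), fun h => hmaps u huD (h ▸ hxqB)⟩
  have hFinj : Set.InjOn F ({ys, yt} : Set X)ᶜ := by
    intro u hu v hv huv
    by_cases huD : u ∈ D <;> by_cases hvD : v ∈ D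
    · rw [hFD u huD, hFD v hvD] at huv
      exact hgi ((hD'mem u).2 ⟨huD, hu⟩) ((hD'mem v).2 ⟨hvD, hv⟩) huv
    · rw [hFD u huD, hFn v hvD] at huv
      exact absurd (huv ▸ (hB'sub _ (hgm ((hD'mem u).2 ⟨huD, hu⟩))).1) (hmaps v hvD)
    · rw [hFn u huD, hFD v hvD] at huv
      exact absurd (huv ▸ (hB'sub _ (hgm ((hD'mem v).2 ⟨hvD, hv⟩))).1) (hmaps u huD)
    · rw [hFn u huD, hFn v hvD] at huv
      exact hinj huD hvD huv
  obtain ⟨Z₀, hxZ, hZ, ⟨y, hyT, hy⟩, hrange⟩ :=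
    exists_orbit_segment F {ys, yt} xp hFinj fun u hu => (hFne u hu).1
  let Z : Finset X := Finset.univ.filter (· ∈ Z₀)
  have hmZ : ∀ u, u ∈ Z ↔ u ∈ Z₀ := fun u => by simp [Z]
  -- Every point of the orbit except its start is a value of `F` off `{ys, yt}`, and `xq` is not.
  have hxqZ : xq ∉ Z := by
    rw [hmZ]
    intro h
    obtain ⟨v, hv, hvq⟩ := hrange xq h (fun h => hpq (by rw [← hxp, ← hxq, h]))
    exact (hFne v hv).2 hvq
  have hxpZ : xp ∈ Z := (hmZ _).2 hxZ
  have hdisj : ∀ u, u ∉ D → u ∉ ({ys, yt} : Set X) := by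
    rintro u hu (rfl | rfl)
    · exact hu hysD
    · exact hu hytD
  -- `Z` contains both or neither of `u` and `g u`, so the paired points cancel colour by colour;
  -- only `xp` and the end of the orbit remain.
  have hcount : ∀ c, (D'.filter fun u => κ u = c ∧ u ∈ Z).card =
      (B'.filter fun u => κ u = c ∧ u ∈ Z).card := by
    intro c
    have hstep : ∀ u ∈ D', (u ∈ Z ↔ g u ∈ Z) := by
      intro u hu
      have h := (hD'mem u).1 hu
      rw [hmZ, hmZ, hZ u h.2, hFD u h.1]
    refine Finset.card_bij (fun u _ => g u) ?_ ?_ ?_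
    · intro u hu
      obtain ⟨h1, h2, h3⟩ := Finset.mem_filter.1 hu
      exact Finset.mem_filter.2 ⟨hgm h1, (hgκ u h1).trans h2, (hstep u h1).1 h3⟩
    · intro u hu v hv huv
      exact hgi (Finset.mem_filter.1 hu).1 (Finset.mem_filter.1 hv).1 huv
    · intro b hb
      obtain ⟨h1, h2, h3⟩ := Finset.mem_filter.1 hb
      obtain ⟨u, hu, rfl⟩ := hgs h1
      exact ⟨u, Finset.mem_filter.2 ⟨hu, (hgκ u hu).symm.trans h2, (hstep u hu).2 h3⟩, rfl⟩
  have hne : ys ≠ yt := fun h => hst (by rw [← hys, ← hyt, h])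
  refine ⟨Z, ?_, κ y, ?_, ?_⟩
  · intro u hu
    rw [hmZ, hmZ, hZ u (hdisj u hu), hFn u hu]
  · rcases hyT with rfl | rfl
    · exact .inl hys
    · exact .inr hyt
  · intro c
    have h1 := cB Z c
    have h2 := cD Z c
    have h3 := hcount c
    simp only [hxpZ, hxqZ, and_true, and_false, if_false] at h1
    have hysZ : ys ∈ Z ↔ ys = y := by rw [hmZ, hy ys (.inl rfl)]
    have hytZ : yt ∈ Z ↔ yt = y := by rw [hmZ, hy yt (.inr rfl)]
    rcases hyT with rfl | rfl
    · simp only [hysZ, hytZ, hne.symm, and_true, and_false, if_false] at h2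
      rw [hys]
      omega
    · simp only [hysZ, hytZ, hne, and_true, and_false, if_false] at h2
      rw [hyt]
      omega

/-! ### Recombination and exchange of bipartite matchings -/

/-- The vertices of one side that are not covered by a set of edges. -/
def uncovered {E U : Type*} [Fintype U] [DecidableEq U] (l : E → U) (M : Finset E) : Finset U :=
  Finset.univ \ M.image l

theorem mem_uncovered {E U : Type*} [Fintype U] [DecidableEq U] {l : E → U} {M : Finset E}
    {u : U} : u ∈ uncovered l M ↔ ∀ e ∈ M, l e ≠ u := by
  simp [uncovered]

theorem card_uncovered {E U : Type*} [Fintype U] [DecidableEq U] {l : E → U} {M : Finset E}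
    (h : Set.InjOn l M) : (uncovered l M).card = Fintype.card U - M.card := by
  rw [uncovered, Finset.card_sdiff_of_subset (Finset.subset_univ _), Finset.card_univ,
    Finset.card_image_of_injOn h]

/-- The edges of `M` outside the part marked by `P`, and the edges of `N` inside it. -/
def recombine {E : Type*} [DecidableEq E] (P : E → Prop) [DecidablePred P] (M N : Finset E) :
    Finset E :=
  M.filter (fun e => ¬ P e) ∪ N.filter P

theorem mem_recombine {E : Type*} [DecidableEq E] {P : E → Prop} [DecidablePred P]
    {M N : Finset E} {e : E} : e ∈ recombine P M N ↔ e ∈ M ∧ ¬ P e ∨ e ∈ N ∧ P e := by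
  simp [recombine]

/-- The two recombined sets have jointly the same edges with multiplicity. This form needs no
cancellation, which fails at `⊥` in `TropNum`. -/
theorem sum_recombine {E α : Type*} [DecidableEq E] [AddCommMonoid α] (P : E → Prop)
    [DecidablePred P] (M N : Finset E) (w : E → α) :
    ∑ e ∈ recombine P M N, w e + ∑ e ∈ recombine P N M, w e = ∑ e ∈ M, w e + ∑ e ∈ N, w e := by
  have hd : ∀ M N : Finset E, Disjoint (M.filter fun e => ¬ P e) (N.filter P) := by
    intro M N
    rw [Finset.disjoint_left]
    intro e he he'
    exact (Finset.mem_filter.1 he).2 (Finset.mem_filter.1 he').2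
  rw [recombine, recombine, Finset.sum_union (hd _ _), Finset.sum_union (hd _ _),
    ← Finset.sum_filter_add_sum_filter_not M P w, ← Finset.sum_filter_add_sum_filter_not N P w]
  abel

/-- The part `P` is cut out by a set `Q` of vertices for both matchings, so an edge kept from `M`
and one taken from `N` cannot share an end. -/
theorem injOn_recombine {E U : Type*} [DecidableEq E] {P : E → Prop} [DecidablePred P]
    {M N : Finset E} {l : E → U} (Q : U → Prop) (hPM : ∀ e ∈ M, P e ↔ Q (l e))
    (hPN : ∀ e ∈ N, P e ↔ Q (l e)) (hM : Set.InjOn l M) (hN : Set.InjOn l N) :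
    Set.InjOn l (recombine P M N) := by
  intro e he f hf hef
  rw [Finset.mem_coe, mem_recombine] at he hf
  rcases he with ⟨he, hpe⟩ | ⟨he, hpe⟩ <;> rcases hf with ⟨hf, hpf⟩ | ⟨hf, hpf⟩
  · exact hM he hf hef
  · exact absurd ((hPM e he).2 (hef ▸ (hPN f hf).1 hpf)) hpe
  · exact absurd ((hPM f hf).2 (hef ▸ (hPN e he).1 hpe)) hpf
  · exact hN he hf hef

theorem mem_uncovered_recombine {E U : Type*} [DecidableEq E] [Fintype U] [DecidableEq U]
    {P : E → Prop} [DecidablePred P] {M N : Finset E} {l : E → U} (Q : U → Prop)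
    (hPM : ∀ e ∈ M, P e ↔ Q (l e)) (hPN : ∀ e ∈ N, P e ↔ Q (l e)) (u : U) :
    u ∈ uncovered l (recombine P M N) ↔
      u ∈ uncovered l M ∧ ¬ Q u ∨ u ∈ uncovered l N ∧ Q u := by
  simp only [mem_uncovered, mem_recombine]
  by_cases hu : Q u
  · simp only [hu, not_true, and_false, and_true, false_or]
    constructor
    · rintro h e he rfl
      exact h e (.inr ⟨he, (hPN e he).2 hu⟩) rfl
    · rintro h e (⟨he, hp⟩ | ⟨he, hp⟩) rfl
      · exact hp ((hPM e he).2 hu)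
      · exact h e he rfl
  · simp only [hu, not_false_iff, and_false, and_true, or_false]
    constructor
    · rintro h e he rfl
      exact h e (.inl ⟨he, fun hp => hu ((hPM e he).1 hp)⟩) rfl
    · rintro h e (⟨he, hp⟩ | ⟨he, hp⟩) rfl
      · exact h e he rfl
      · exact hu ((hPN e he).1 hp)

theorem card_filter_uncovered_recombine {E U C : Type*} [DecidableEq E] [Fintype U]
    [DecidableEq U] [DecidableEq C] {P : E → Prop} [DecidablePred P] {M N : Finset E} {l : E → U}
    (Q : U → Prop) [DecidablePred Q] (hPM : ∀ e ∈ M, P e ↔ Q (l e))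
    (hPN : ∀ e ∈ N, P e ↔ Q (l e)) (κ : U → C) (c : C) :
    ((uncovered l (recombine P M N)).filter (κ · = c)).card +
        ((uncovered l M).filter fun u => κ u = c ∧ Q u).card =
      ((uncovered l M).filter (κ · = c)).card +
        ((uncovered l N).filter fun u => κ u = c ∧ Q u).card := by
  have h1 : (uncovered l (recombine P M N)).filter (κ · = c) =
      ((uncovered l M).filter fun u => κ u = c ∧ ¬ Q u) ∪
        ((uncovered l N).filter fun u => κ u = c ∧ Q u) := by
    ext u
    simp only [Finset.mem_filter, Finset.mem_union, mem_uncovered_recombine Q hPM hPN]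
    tauto
  have h2 : (uncovered l M).filter (κ · = c) =
      ((uncovered l M).filter fun u => κ u = c ∧ ¬ Q u) ∪
        ((uncovered l M).filter fun u => κ u = c ∧ Q u) := by
    ext u
    simp only [Finset.mem_filter, Finset.mem_union]
    tauto
  have hd : ∀ A : Finset U, Disjoint ((uncovered l M).filter fun u => κ u = c ∧ ¬ Q u)
      (A.filter fun u => κ u = c ∧ Q u) := by
    intro A
    rw [Finset.disjoint_left]
    intro e he he'
    exact (Finset.mem_filter.1 he).2.2 (Finset.mem_filter.1 he').2.2
  rw [h1, h2, Finset.card_union_of_disjoint (hd _), Finset.card_union_of_disjoint (hd _)]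
  ring

theorem card_filter_disjSum_some {U C : Type*} [DecidableEq C] (κ : U → C) (B B' : Finset U)
    (Q : U ⊕ U → Prop) [DecidablePred Q] (c : C) :
    ((B.disjSum B').filter fun x =>
      Sum.elim (some ∘ κ) (fun _ => none) x = some c ∧ Q x).card =
      (B.filter fun u => κ u = c ∧ Q (.inl u)).card := by
  have : ((B.disjSum B').filter fun x =>
      Sum.elim (some ∘ κ) (fun _ => none) x = some c ∧ Q x) =
      (B.filter fun u => κ u = c ∧ Q (.inl u)).map Function.Embedding.inl := by
    ext (u | u) <;> simp
  rw [this, Finset.card_map]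

theorem card_filter_disjSum_none {U C : Type*} [DecidableEq C] (κ : U → C) (B B' : Finset U) :
    ((B.disjSum B').filter fun x =>
      Sum.elim (some ∘ κ) (fun _ => none) x = (none : Option C)).card = B'.card := by
  have : ((B.disjSum B').filter fun x =>
      Sum.elim (some ∘ κ) (fun _ => none) x = (none : Option C)) =
      B'.map Function.Embedding.inr := by
    ext (u | u) <;> simp
  rw [this, Finset.card_map]

/-- Exchange property of matchings in a bipartite multigraph with equally large sides: the left
vertices are coloured, and the colours of the uncovered ones are counted. -/
theorem exists_matching_exchange {E U C : Type*} [DecidableEq E] [Fintype U] [DecidableEq U]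
    [Fintype C] [DecidableEq C] (l r : E → U) (κ : U → C) (M N : Finset E)
    (hlM : Set.InjOn l M) (hrM : Set.InjOn r M) (hlN : Set.InjOn l N) (hrN : Set.InjOn r N)
    (t : C → ℕ) (p q s : C) (hpq : p ≠ q) (hps : p ≠ s) (hqs : q ≠ s)
    (hM : ∀ c, ((uncovered l M).filter (κ · = c)).card = t c + if c = s then 1 else 0)
    (hN : ∀ c, ((uncovered l N).filter (κ · = c)).card =
      t c + ((if c = p then 1 else 0) + if c = q then 1 else 0)) :
    ∃ M' N' : Finset E, Set.InjOn l M' ∧ Set.InjOn r M' ∧ Set.InjOn l N' ∧ Set.InjOn r N' ∧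
      (∀ w : E → TropNum, ∑ e ∈ M', w e + ∑ e ∈ N', w e = ∑ e ∈ M, w e + ∑ e ∈ N, w e) ∧
      uncovered l M' ∪ uncovered l N' ⊆ uncovered l M ∪ uncovered l N ∧
      uncovered r M' ∪ uncovered r N' ⊆ uncovered r M ∪ uncovered r N ∧
      ((∀ c, ((uncovered l M').filter (κ · = c)).card = t c + (if c = p then 1 else 0) ∧
          ((uncovered l N').filter (κ · = c)).card =
            t c + ((if c = q then 1 else 0) + if c = s then 1 else 0)) ∨
        ∀ c, ((uncovered l M').filter (κ · = c)).card =
            t c + ((if c = p then 1 else 0) + if c = s then 1 else 0) ∧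
          ((uncovered l N').filter (κ · = c)).card = t c + (if c = q then 1 else 0)) := by
  classical
  -- All right vertices share the extra colour `none`: only the colours on the left have to be
  -- distinguished.
  let κ' : U ⊕ U → Option C := Sum.elim (some ∘ κ) fun _ => none
  -- One step of the alternating walk: left to right along `M`, right to left along `N`. It stops on
  -- `D` and its values off `D` avoid `B`, the sets defined below.
  let f : U ⊕ U → U ⊕ U := Sum.elim
    (fun u => if h : ∃ e ∈ M, l e = u then .inr (r h.choose) else .inl u)
    (fun v => if h : ∃ e ∈ N, r e = v then .inl (l h.choose) else .inr v)
  have hfM : ∀ e ∈ M, f (.inl (l e)) = .inr (r e) := by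
    intro e he
    have h : ∃ e' ∈ M, l e' = l e := ⟨e, he, rfl⟩
    have : h.choose = e := hlM h.choose_spec.1 he h.choose_spec.2
    simp only [f, Sum.elim_inl, dif_pos h, this]
  have hfN : ∀ e ∈ N, f (.inr (r e)) = .inl (l e) := by
    intro e he
    have h : ∃ e' ∈ N, r e' = r e := ⟨e, he, rfl⟩
    have : h.choose = e := hrN h.choose_spec.1 he h.choose_spec.2
    simp only [f, Sum.elim_inr, dif_pos h, this]
  let B := (uncovered l N).disjSum (uncovered r M)
  let D := (uncovered l M).disjSum (uncovered r N)
  have hD : ∀ x, x ∉ D → (∃ e ∈ M, x = .inl (l e)) ∨ ∃ e ∈ N, x = .inr (r e) := by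
    rintro (u | v) hx
    · simp only [D, Finset.inl_mem_disjSum, mem_uncovered] at hx
      push Not at hx
      obtain ⟨e, he, rfl⟩ := hx
      exact .inl ⟨e, he, rfl⟩
    · simp only [D, Finset.inr_mem_disjSum, mem_uncovered] at hx
      push Not at hx
      obtain ⟨e, he, rfl⟩ := hx
      exact .inr ⟨e, he, rfl⟩
  have sumcard : ∀ A : Finset U, A.card = ∑ c, (A.filter (κ · = c)).card := fun A =>
    Finset.card_eq_sum_card_fiberwise (fun _ _ => Finset.mem_coe.2 (Finset.mem_univ _))
  -- A matching leaves equally many vertices uncovered on both sides. Thus `D` has one more point of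
  -- colour `none` than `B`, which provides the second deficit needed for the invariant set.
  have hMr : (uncovered r M).card = ∑ c, t c + 1 := by
    rw [card_uncovered hrM, ← card_uncovered hlM, sumcard]
    simp [hM, Finset.sum_add_distrib]
  have hNr : (uncovered r N).card = ∑ c, t c + 2 := by
    rw [card_uncovered hrN, ← card_uncovered hlN, sumcard]
    simp [hN, Finset.sum_add_distrib]
  have some_card : ∀ (A A' : Finset U) c, ((A.disjSum A').filter (κ' · = some c)).card =
      (A.filter (κ · = c)).card := by
    intro A A' c
    simpa using card_filter_disjSum_some κ A A' (fun _ => True) c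
  obtain ⟨Z, hZ, y, hy, hcount⟩ := exists_invariant_set f κ' B D
    (by
      intro x hx x' hx' h
      rcases hD x hx with ⟨e, he, rfl⟩ | ⟨e, he, rfl⟩ <;>
        rcases hD x' hx' with ⟨e', he', rfl⟩ | ⟨e', he', rfl⟩
      · rw [hfM e he, hfM e' he'] at h
        rw [hrM he he' (Sum.inr_injective h)]
      · rw [hfM e he, hfN e' he'] at h
        cases h
      · rw [hfN e he, hfM e' he'] at h
        cases h
      · rw [hfN e he, hfN e' he'] at h
        rw [hlN he he' (Sum.inl_injective h)])
    (by
      intro x hx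
      rcases hD x hx with ⟨e, he, rfl⟩ | ⟨e, he, rfl⟩
      · rw [hfM e he, Finset.inr_mem_disjSum, mem_uncovered]
        exact fun h => h e he rfl
      · rw [hfN e he, Finset.inl_mem_disjSum, mem_uncovered]
        exact fun h => h e he rfl)
    (some p) (some q) (some s) none (by simpa) (by simp) (by simpa) (by simp) (by simpa)
    (by simp)
    (by
      rintro (_ | c)
      · rw [card_filter_disjSum_none, card_filter_disjSum_none, hMr, hNr]
        simp
      · rw [some_card, some_card, hM, hN]
        simp only [Option.some.injEq, reduceCtorEq, if_false]
        ring)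
  have hclM : ∀ e ∈ M, (Sum.inl (l e) ∈ Z ↔ Sum.inr (r e) ∈ Z) := by
    intro e he
    rw [hZ (.inl (l e)), hfM e he]
    rw [Finset.inl_mem_disjSum, mem_uncovered]
    exact fun h => h e he rfl
  have hclN : ∀ e ∈ N, (Sum.inl (l e) ∈ Z ↔ Sum.inr (r e) ∈ Z) := by
    intro e he
    rw [hZ (.inr (r e)), hfN e he]
    rw [Finset.inr_mem_disjSum, mem_uncovered]
    exact fun h => h e he rfl
  let P : E → Prop := fun e => Sum.inl (l e) ∈ Z
  let Ql : U → Prop := fun u => Sum.inl u ∈ Z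
  let Qr : U → Prop := fun u => Sum.inr u ∈ Z
  -- A vertex covered by both old matchings is covered by both new ones; for linkings this keeps the
  -- starting points in `S` and the ends in `K`.
  have unc : ∀ (k : E → U) (Q : U → Prop), (∀ e ∈ M, P e ↔ Q (k e)) →
      (∀ e ∈ N, P e ↔ Q (k e)) → uncovered k (recombine P M N) ∪ uncovered k (recombine P N M) ⊆
        uncovered k M ∪ uncovered k N := by
    intro k Q h1 h2 u hu
    rw [Finset.mem_union, mem_uncovered_recombine Q h1 h2, mem_uncovered_recombine Q h2 h1] at hu
    rw [Finset.mem_union]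
    tauto
  refine ⟨recombine P M N, recombine P N M,
    injOn_recombine Ql (fun _ _ => .rfl) (fun _ _ => .rfl) hlM hlN,
    injOn_recombine Qr hclM hclN hrM hrN,
    injOn_recombine Ql (fun _ _ => .rfl) (fun _ _ => .rfl) hlN hlM,
    injOn_recombine Qr hclN hclM hrN hrM, fun w => sum_recombine P M N w,
    unc l Ql (fun _ _ => .rfl) (fun _ _ => .rfl), unc r Qr hclM hclN, ?_⟩
  have cM := card_filter_uncovered_recombine (P := P) (M := M) (N := N) (l := l) Ql
    (fun _ _ => .rfl) (fun _ _ => .rfl) κ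
  have cN := card_filter_uncovered_recombine (P := P) (M := N) (N := M) (l := l) Ql
    (fun _ _ => .rfl) (fun _ _ => .rfl) κ
  have cc : ∀ c, ((uncovered l N).filter fun u => κ u = c ∧ Ql u).card +
      (if some c = y then 1 else 0) =
      ((uncovered l M).filter fun u => κ u = c ∧ Ql u).card + (if c = p then 1 else 0) := by
    intro c
    have := hcount (some c)
    rw [card_filter_disjSum_some, card_filter_disjSum_some] at this
    simpa only [Option.some.injEq] using this
  -- The interchange on `Z` moves one `p` from the uncovered left vertices of `N` to those of `M`.
  -- An orbit ending at `s` also moves one `s` back; an orbit ending on the right changes no other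
  -- left count.
  rcases hy with rfl | rfl
  · left
    intro c
    have h1 := cM c
    have h2 := cN c
    have h3 := cc c
    rw [hM] at h1
    rw [hN] at h2
    simp only [Option.some.injEq] at h3
    constructor <;> omega
  · right
    intro c
    have h1 := cM c
    have h2 := cN c
    have h3 := cc c
    rw [hM] at h1
    rw [hN] at h2
    simp only [reduceCtorEq, if_false] at h3
    constructor <;> omega

/-! ### Linkings as matchings -/

/-- The edge set of a family of vertex-disjoint paths from `S` to `K`, in an acyclic graph. -/
structure IsLinking {V E : Type*} (src tgt : E → V) (S K : Set V) (F : Finset E) : Prop where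
  src_inj : Set.InjOn src F
  tgt_inj : Set.InjOn tgt F
  src_mem : ∀ e ∈ F, src e ∈ S ∨ ∃ f ∈ F, tgt f = src e
  tgt_mem : ∀ e ∈ F, tgt e ∈ K ∨ ∃ f ∈ F, src f = tgt e

/-- The final vertices of the paths of a linking. -/
def terminals {V E : Type*} [DecidableEq V] (src tgt : E → V) (F : Finset E) : Finset V :=
  F.image tgt \ F.image src

theorem mem_terminals {V E : Type*} [DecidableEq V] {src tgt : E → V} {F : Finset E} {v : V} :
    v ∈ terminals src tgt F ↔ (∃ e ∈ F, tgt e = v) ∧ ∀ e ∈ F, src e ≠ v := by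
  simp [terminals]

theorem IsLinking.terminals_subset {V E : Type*} [DecidableEq V] {src tgt : E → V}
    {S K : Set V} {F : Finset E} (h : IsLinking src tgt S K F) {v : V}
    (hv : v ∈ terminals src tgt F) : v ∈ K := by
  obtain ⟨⟨e, he, rfl⟩, h2⟩ := mem_terminals.1 hv
  rcases h.tgt_mem e he with h' | ⟨f, hf, h'⟩
  · exact h'
  · exact absurd h' (h2 f hf)

/-- The edges of a matching between two copies of the vertex set that are not of the form
`(v, v)`. -/
noncomputable def matchingEdges {V E : Type*} (M : Finset (E ⊕ V)) : Finset E :=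
  M.preimage Sum.inl Sum.inl_injective.injOn

theorem mem_matchingEdges {V E : Type*} {M : Finset (E ⊕ V)} {e : E} :
    e ∈ matchingEdges M ↔ .inl e ∈ M := by
  simp [matchingEdges]

theorem sum_matchingEdges {V E : Type*} (M : Finset (E ⊕ V)) (w : E → TropNum) :
    ∑ e ∈ matchingEdges M, w e = ∑ e ∈ M, Sum.elim w (fun _ => 0) e := by
  have : M = (matchingEdges M).disjSum (M.preimage Sum.inr Sum.inr_injective.injOn) := by
    ext (e | v) <;> simp [mem_matchingEdges]
  conv_rhs => rw [this]
  simp [Finset.sum_disjSum]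

section Linking

variable {V E : Type*} [Fintype V] [DecidableEq V] {src tgt : E → V} {S K : Set V} {F : Finset E}

/-- A linking as a matching between two copies of the vertex set, in which every vertex that is
not visited is matched with its copy. -/
def linkingMatching (src tgt : E → V) (F : Finset E) : Finset (E ⊕ V) :=
  F.disjSum (Finset.univ \ (F.image src ∪ F.image tgt))

theorem inl_mem_linkingMatching {e : E} :
    .inl e ∈ linkingMatching src tgt F ↔ e ∈ F := by
  simp [linkingMatching]

theorem inr_mem_linkingMatching {v : V} :
    .inr v ∈ linkingMatching src tgt F ↔ (∀ e ∈ F, src e ≠ v) ∧ ∀ e ∈ F, tgt e ≠ v := by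
  simp [linkingMatching]

theorem sum_linkingMatching (w : E → TropNum) :
    ∑ e ∈ linkingMatching src tgt F, Sum.elim w (fun _ => 0) e = ∑ e ∈ F, w e := by
  simp [linkingMatching, Finset.sum_disjSum]

theorem injOn_src_linkingMatching (h : Set.InjOn src F) :
    Set.InjOn (Sum.elim src id) (linkingMatching src tgt F : Set (E ⊕ V)) := by
  rintro (e | u) he (f | v) hf h'
  · rw [Finset.mem_coe, inl_mem_linkingMatching] at he hf
    rw [h he hf h']
  · rw [Finset.mem_coe, inl_mem_linkingMatching] at he
    rw [Finset.mem_coe, inr_mem_linkingMatching] at hf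
    exact absurd h' (hf.1 e he)
  · rw [Finset.mem_coe, inr_mem_linkingMatching] at he
    rw [Finset.mem_coe, inl_mem_linkingMatching] at hf
    exact absurd h'.symm (he.1 f hf)
  · exact congrArg _ h'

theorem injOn_tgt_linkingMatching (h : Set.InjOn tgt F) :
    Set.InjOn (Sum.elim tgt id) (linkingMatching src tgt F : Set (E ⊕ V)) := by
  rintro (e | u) he (f | v) hf h'
  · rw [Finset.mem_coe, inl_mem_linkingMatching] at he hf
    rw [h he hf h']
  · rw [Finset.mem_coe, inl_mem_linkingMatching] at he
    rw [Finset.mem_coe, inr_mem_linkingMatching] at hf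
    exact absurd h' (hf.2 e he)
  · rw [Finset.mem_coe, inr_mem_linkingMatching] at he
    rw [Finset.mem_coe, inl_mem_linkingMatching] at hf
    exact absurd h'.symm (he.2 f hf)
  · exact congrArg _ h'

theorem uncovered_src_linkingMatching :
    uncovered (Sum.elim src id) (linkingMatching src tgt F) = terminals src tgt F := by
  ext v
  simp only [mem_uncovered, mem_terminals, Sum.forall, Sum.elim_inl, Sum.elim_inr,
    inl_mem_linkingMatching, inr_mem_linkingMatching, id]
  constructor
  · rintro ⟨h1, h2⟩
    refine ⟨?_, h1⟩
    by_contra! h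
    exact h2 v ⟨h1, h⟩ rfl
  · rintro ⟨⟨e, he, rfl⟩, h2⟩
    refine ⟨h2, ?_⟩
    rintro v ⟨_, h4⟩ rfl
    exact h4 e he rfl

theorem IsLinking.uncovered_tgt_subset (h : IsLinking src tgt S K F) {v : V}
    (hv : v ∈ uncovered (Sum.elim tgt id) (linkingMatching src tgt F)) : v ∈ S := by
  simp only [mem_uncovered, Sum.forall, Sum.elim_inl, Sum.elim_inr,
    inl_mem_linkingMatching, inr_mem_linkingMatching, id] at hv
  have : ∃ e ∈ F, src e = v := by
    by_contra! h'
    exact hv.2 v ⟨h', hv.1⟩ rfl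
  obtain ⟨e, he, rfl⟩ := this
  rcases h.src_mem e he with h' | ⟨f, hf, h'⟩
  · exact h'
  · exact absurd h' (hv.1 f hf)

/-- If the source of a chosen edge is covered on the right, the covering element is an edge, because
a loop there would cover the left copy twice; that edge precedes the given one. If it is uncovered,
it lies in `S`. Targets are symmetric. -/
theorem isLinking_matchingEdges {M : Finset (E ⊕ V)}
    (hl : Set.InjOn (Sum.elim src id) (M : Set (E ⊕ V)))
    (hr : Set.InjOn (Sum.elim tgt id) (M : Set (E ⊕ V)))
    (hK : ∀ v ∈ uncovered (Sum.elim src id) M, v ∈ K)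
    (hS : ∀ v ∈ uncovered (Sum.elim tgt id) M, v ∈ S) :
    IsLinking src tgt S K (matchingEdges M) where
  src_inj e he f hf h := Sum.inl_injective
    (hl (mem_matchingEdges.1 he) (mem_matchingEdges.1 hf) h)
  tgt_inj e he f hf h := Sum.inl_injective
    (hr (mem_matchingEdges.1 he) (mem_matchingEdges.1 hf) h)
  src_mem e he := by
    by_contra! h
    refine h.1 (hS _ (mem_uncovered.2 ?_))
    rintro (f | v) hf h'
    · exact h.2 f (mem_matchingEdges.2 hf) h'
    · exact Sum.inl_ne_inr (hl (mem_matchingEdges.1 he) hf h'.symm)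
  tgt_mem e he := by
    by_contra! h
    refine h.1 (hK _ (mem_uncovered.2 ?_))
    rintro (f | v) hf h'
    · exact h.2 f (mem_matchingEdges.2 hf) h'
    · exact Sum.inl_ne_inr (hr (mem_matchingEdges.1 he) hf h'.symm)

/-- Disjointness of `S` and `K` excludes paths of length zero: an uncovered left vertex that no edge
enters would be uncovered on the right as well, hence in both sets. -/
theorem terminals_matchingEdges {M : Finset (E ⊕ V)} (hSK : Disjoint S K)
    (hr : Set.InjOn (Sum.elim tgt id) (M : Set (E ⊕ V)))
    (hK : ∀ v ∈ uncovered (Sum.elim src id) M, v ∈ K)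
    (hS : ∀ v ∈ uncovered (Sum.elim tgt id) M, v ∈ S) :
    terminals src tgt (matchingEdges M) = uncovered (Sum.elim src id) M := by
  ext v
  constructor
  · intro hv
    obtain ⟨⟨e, he, rfl⟩, h2⟩ := mem_terminals.1 hv
    refine mem_uncovered.2 ?_
    rintro (f | v) hf h'
    · exact h2 f (mem_matchingEdges.2 hf) h'
    · exact Sum.inl_ne_inr (hr (mem_matchingEdges.1 he) hf h'.symm)
  · intro hv
    have hvK := hK v hv
    rw [mem_uncovered] at hv
    refine mem_terminals.2 ⟨?_, fun e he => hv _ (mem_matchingEdges.1 he)⟩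
    by_contra! h
    refine Set.disjoint_left.1 hSK (hS v (mem_uncovered.2 ?_)) hvK
    rintro (f | u) hf h'
    · exact h f (mem_matchingEdges.2 hf) h'
    · exact hv _ hf h'

/-- Exchange property of linkings, where terminals are counted by colour. -/
theorem exists_linking_exchange {C : Type*} [Fintype C] [DecidableEq C] (hSK : Disjoint S K)
    (κ : V → C) {F G : Finset E} (hF : IsLinking src tgt S K F) (hG : IsLinking src tgt S K G)
    (t : C → ℕ) (p q s : C) (hpq : p ≠ q) (hps : p ≠ s) (hqs : q ≠ s)
    (hFt : ∀ c, ((terminals src tgt F).filter (κ · = c)).card = t c + if c = s then 1 else 0)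
    (hGt : ∀ c, ((terminals src tgt G).filter (κ · = c)).card =
      t c + ((if c = p then 1 else 0) + if c = q then 1 else 0)) (w : E → TropNum) :
    ∃ F' G' : Finset E, IsLinking src tgt S K F' ∧ IsLinking src tgt S K G' ∧
      ∑ e ∈ F', w e + ∑ e ∈ G', w e = ∑ e ∈ F, w e + ∑ e ∈ G, w e ∧
      ((∀ c, ((terminals src tgt F').filter (κ · = c)).card = t c + (if c = p then 1 else 0) ∧
          ((terminals src tgt G').filter (κ · = c)).card =
            t c + ((if c = q then 1 else 0) + if c = s then 1 else 0)) ∨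
        ∀ c, ((terminals src tgt F').filter (κ · = c)).card =
            t c + ((if c = p then 1 else 0) + if c = s then 1 else 0) ∧
          ((terminals src tgt G').filter (κ · = c)).card = t c + (if c = q then 1 else 0)) := by
  classical
  obtain ⟨M, N, hlM, hrM, hlN, hrN, hw, hul, hur, hcard⟩ :=
    exists_matching_exchange (Sum.elim src id) (Sum.elim tgt id) κ (linkingMatching src tgt F)
      (linkingMatching src tgt G) (injOn_src_linkingMatching hF.src_inj)
      (injOn_tgt_linkingMatching hF.tgt_inj) (injOn_src_linkingMatching hG.src_inj)
      (injOn_tgt_linkingMatching hG.tgt_inj) t p q s hpq hps hqs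
      (by simpa only [uncovered_src_linkingMatching] using hFt)
      (by simpa only [uncovered_src_linkingMatching] using hGt)
  have hK : ∀ v ∈ uncovered (Sum.elim src id) M ∪ uncovered (Sum.elim src id) N, v ∈ K := by
    intro v hv
    rcases Finset.mem_union.1 (hul hv) with h | h
    · exact hF.terminals_subset (uncovered_src_linkingMatching (src := src) ▸ h)
    · exact hG.terminals_subset (uncovered_src_linkingMatching (src := src) ▸ h)
  have hS : ∀ v ∈ uncovered (Sum.elim tgt id) M ∪ uncovered (Sum.elim tgt id) N, v ∈ S := by
    intro v hv
    rcases Finset.mem_union.1 (hur hv) with h | h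
    · exact hF.uncovered_tgt_subset h
    · exact hG.uncovered_tgt_subset h
  have hKM := fun v hv => hK v (Finset.mem_union_left _ hv)
  have hKN := fun v hv => hK v (Finset.mem_union_right _ hv)
  have hSM := fun v hv => hS v (Finset.mem_union_left _ hv)
  have hSN := fun v hv => hS v (Finset.mem_union_right _ hv)
  refine ⟨matchingEdges M, matchingEdges N, isLinking_matchingEdges hlM hrM hKM hSM,
    isLinking_matchingEdges hlN hrN hKN hSN, ?_, ?_⟩
  · rw [sum_matchingEdges, sum_matchingEdges, hw, sum_linkingMatching, sum_linkingMatching]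
  · rw [terminals_matchingEdges hSK hrM hKM hSM, terminals_matchingEdges hSK hrN hKN hSN]
    exact hcard

end Linking

/-! ### Paths as edge sets, and decomposition of linkings -/

/-- `l` consists of the edges of a path from `S` to `v` that does not return to any vertex. -/
structure IsTrack {V E : Type*} (src tgt : E → V) (S : Set V) (l : List E) (v : V) : Prop where
  nodup : l.Nodup
  src_inj : ∀ e ∈ l, ∀ f ∈ l, src e = src f → e = f
  tgt_inj : ∀ e ∈ l, ∀ f ∈ l, tgt e = tgt f → e = f
  back : ∀ e ∈ l, src e ∈ S ∨ ∃ f ∈ l, tgt f = src e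
  fwd : ∀ e ∈ l, tgt e = v ∨ ∃ f ∈ l, src f = tgt e
  last : ∃ e ∈ l, tgt e = v
  final : ∀ e ∈ l, src e ≠ v

/-- The vertices on a list of edges. -/
def edgeVerts {V E : Type*} (src tgt : E → V) (l : List E) : Set V :=
  {u | ∃ e ∈ l, u = src e ∨ u = tgt e}

theorem src_mem_edgeVerts {V E : Type*} {src tgt : E → V} {l : List E} {e : E} (he : e ∈ l) :
    src e ∈ edgeVerts src tgt l := ⟨e, he, .inl rfl⟩

theorem tgt_mem_edgeVerts {V E : Type*} {src tgt : E → V} {l : List E} {e : E} (he : e ∈ l) :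
    tgt e ∈ edgeVerts src tgt l := ⟨e, he, .inr rfl⟩

theorem IsTrack.end_mem_edgeVerts {V E : Type*} {src tgt : E → V} {S : Set V} {l : List E} {v : V}
    (h : IsTrack src tgt S l v) : v ∈ edgeVerts src tgt l := by
  obtain ⟨e, he, h⟩ := h.last
  exact h ▸ tgt_mem_edgeVerts he

theorem end_injective {V E I : Type*} {src tgt : E → V} {S : Set V} {L : I → List E} {v : I → V}
    (hL : ∀ i, IsTrack src tgt S (L i) (v i))
    (hd : ∀ i j, i ≠ j → Disjoint (edgeVerts src tgt (L i)) (edgeVerts src tgt (L j))) :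
    Function.Injective v := by
  intro i j hij
  by_contra h
  exact Set.disjoint_left.1 (hd i j h) (hL i).end_mem_edgeVerts (hij ▸ (hL j).end_mem_edgeVerts)

section Tracks

variable {V E I : Type*} [DecidableEq E] [Fintype I] {src tgt : E → V} {S K : Set V}
  {L : I → List E} {v : I → V}

/-- The edges of a family of lists. -/
def edgeUnion (L : I → List E) : Finset E := Finset.univ.biUnion fun i => (L i).toFinset

theorem mem_edgeUnion {e : E} : e ∈ edgeUnion L ↔ ∃ i, e ∈ L i := by
  simp [edgeUnion]

theorem sum_edgeUnion (hL : ∀ i, (L i).Nodup)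
    (hd : ∀ i j, i ≠ j → Disjoint (edgeVerts src tgt (L i)) (edgeVerts src tgt (L j)))
    (w : E → TropNum) : ∑ e ∈ edgeUnion L, w e = ∑ i, ((L i).map w).sum := by
  rw [edgeUnion, Finset.sum_biUnion]
  · exact Finset.sum_congr rfl fun i _ => List.sum_toFinset w (hL i)
  · intro i _ j _ hij
    rw [Function.onFun, Finset.disjoint_left]
    intro e he he'
    exact Set.disjoint_left.1 (hd i j hij) (src_mem_edgeVerts (List.mem_toFinset.1 he))
      (src_mem_edgeVerts (List.mem_toFinset.1 he'))

theorem isLinking_edgeUnion (hL : ∀ i, IsTrack src tgt S (L i) (v i))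
    (hd : ∀ i j, i ≠ j → Disjoint (edgeVerts src tgt (L i)) (edgeVerts src tgt (L j)))
    (hK : ∀ i, v i ∈ K) : IsLinking src tgt S K (edgeUnion L) where
  src_inj e he f hf h := by
    obtain ⟨i, hi⟩ := mem_edgeUnion.1 he
    obtain ⟨j, hj⟩ := mem_edgeUnion.1 hf
    obtain rfl : i = j := by
      by_contra hij
      exact Set.disjoint_left.1 (hd i j hij) (src_mem_edgeVerts hi) (h ▸ src_mem_edgeVerts hj)
    exact (hL i).src_inj e hi f hj h
  tgt_inj e he f hf h := by
    obtain ⟨i, hi⟩ := mem_edgeUnion.1 he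
    obtain ⟨j, hj⟩ := mem_edgeUnion.1 hf
    obtain rfl : i = j := by
      by_contra hij
      exact Set.disjoint_left.1 (hd i j hij) (tgt_mem_edgeVerts hi) (h ▸ tgt_mem_edgeVerts hj)
    exact (hL i).tgt_inj e hi f hj h
  src_mem e he := by
    obtain ⟨i, hi⟩ := mem_edgeUnion.1 he
    exact ((hL i).back e hi).imp_right fun ⟨f, hf, h⟩ => ⟨f, mem_edgeUnion.2 ⟨i, hf⟩, h⟩
  tgt_mem e he := by
    obtain ⟨i, hi⟩ := mem_edgeUnion.1 he
    exact ((hL i).fwd e hi).imp (fun h : tgt e = v i => h ▸ hK i)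
      fun ⟨f, hf, h⟩ => ⟨f, mem_edgeUnion.2 ⟨i, hf⟩, h⟩

theorem terminals_edgeUnion [DecidableEq V] (hL : ∀ i, IsTrack src tgt S (L i) (v i))
    (hd : ∀ i j, i ≠ j → Disjoint (edgeVerts src tgt (L i)) (edgeVerts src tgt (L j))) :
    terminals src tgt (edgeUnion L) = Finset.univ.image v := by
  ext u
  simp only [mem_terminals, Finset.mem_image, Finset.mem_univ, true_and]
  constructor
  · rintro ⟨⟨e, he, rfl⟩, h2⟩
    obtain ⟨i, hi⟩ := mem_edgeUnion.1 he
    rcases (hL i).fwd e hi with h | ⟨f, hf, h⟩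
    · exact ⟨i, h.symm⟩
    · exact absurd h (h2 f (mem_edgeUnion.2 ⟨i, hf⟩))
  · rintro ⟨i, rfl⟩
    obtain ⟨e, he, h⟩ := (hL i).last
    refine ⟨⟨e, mem_edgeUnion.2 ⟨i, he⟩, h⟩, ?_⟩
    intro f hf hf'
    obtain ⟨j, hj⟩ := mem_edgeUnion.1 hf
    by_cases hij : i = j
    · subst hij
      exact (hL i).final f hj hf'
    · exact Set.disjoint_left.1 (hd i j hij) (hL i).end_mem_edgeVerts
        (hf' ▸ src_mem_edgeVerts hj)

end Tracks

section Decomposition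

variable {V E : Type*} [DecidableEq V] {src tgt : E → V} {S K : Set V} {F : Finset E}

theorem wellFounded_rank_gt {E : Type*} [Finite E] (ρ : E → ℝ) :
    WellFounded fun e f => ρ f < ρ e := by
  have : IsTrans E fun e f => ρ f < ρ e := ⟨fun _ _ _ h1 h2 => h2.trans h1⟩
  have : Std.Irrefl fun e f => ρ f < ρ e := ⟨fun _ => lt_irrefl _⟩
  exact Finite.wellFounded_of_trans_of_irrefl _

theorem wellFounded_rank_lt {E : Type*} [Finite E] (ρ : E → ℝ) :
    WellFounded fun e f => ρ e < ρ f := by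
  simpa using wellFounded_rank_gt fun e => - ρ e

/-- Successors inside a linking are unique, so two tracks with a common edge agree from there on.
The induction passes to edges of higher rank and stops at the common end. -/
theorem end_eq_of_common_edge [Finite E] (ρ : V → ℝ) (hρ : ∀ e, ρ (src e) < ρ (tgt e))
    (hF : IsLinking src tgt S K F) {l l' : List E} {v v' : V} (hl : IsTrack src tgt S l v)
    (hl' : IsTrack src tgt S l' v') (hlF : ∀ e ∈ l, e ∈ F) (hlF' : ∀ e ∈ l', e ∈ F)
    (hv : v ∈ terminals src tgt F) (hv' : v' ∈ terminals src tgt F) (e : E) (he : e ∈ l)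
    (he' : e ∈ l') : v = v' := by
  induction e using (wellFounded_rank_gt fun e => ρ (src e)).induction with
  | _ e ih =>
    rcases hl.fwd e he with h | ⟨f, hf, h⟩ <;> rcases hl'.fwd e he' with h' | ⟨f', hf', h'⟩
    · exact h.symm.trans h'
    · exact absurd (h'.trans h) ((mem_terminals.1 hv).2 f' (hlF' f' hf'))
    · exact absurd (h.trans h') ((mem_terminals.1 hv').2 f (hlF f hf))
    · obtain rfl := hF.src_inj (hlF f hf) (hlF' f' hf') (h.trans h'.symm)
      exact ih f (by rw [h]; exact hρ e) hf hf'

/-- A common vertex would give a common edge. In the mixed case, where it is left by one track and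
entered by the other, it is not in `S`, so the first track also enters it, by the same edge. -/
theorem disjoint_edgeVerts_of_end_ne [Finite E] (ρ : V → ℝ) (hρ : ∀ e, ρ (src e) < ρ (tgt e))
    (hS : ∀ e, tgt e ∉ S) (hF : IsLinking src tgt S K F) {l l' : List E} {v v' : V}
    (hl : IsTrack src tgt S l v) (hl' : IsTrack src tgt S l' v') (hlF : ∀ e ∈ l, e ∈ F)
    (hlF' : ∀ e ∈ l', e ∈ F) (hv : v ∈ terminals src tgt F) (hv' : v' ∈ terminals src tgt F)
    (hne : v ≠ v') : Disjoint (edgeVerts src tgt l) (edgeVerts src tgt l') := by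
  have key : ∀ e ∈ l, e ∉ l' := fun e he he' =>
    hne (end_eq_of_common_edge ρ hρ hF hl hl' hlF hlF' hv hv' e he he')
  rw [Set.disjoint_left]
  rintro u ⟨e, he, hu⟩ ⟨f, hf, hu'⟩
  rcases hu with rfl | rfl <;> rcases hu' with h | h
  · exact key e he (hF.src_inj (hlF e he) (hlF' f hf) h ▸ hf)
  · rcases hl.back e he with h' | ⟨e', he', h'⟩
    · exact hS f (h ▸ h')
    · exact key e' he' (hF.tgt_inj (hlF e' he') (hlF' f hf) (h'.trans h) ▸ hf)
  · rcases hl'.back f hf with h' | ⟨f', hf', h'⟩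
    · exact hS e (h.symm ▸ h')
    · exact key e he (hF.tgt_inj (hlF' f' hf') (hlF e he) (h'.trans h.symm) ▸ hf')
  · exact key e he (hF.tgt_inj (hlF e he) (hlF' f hf) h ▸ hf)

/-- Acyclicity rules out leftover cycles: following successors from any edge reaches a terminal, and
a track containing the successor also contains the unique edge before it. -/
theorem exists_track_mem [Finite E] {I : Type*} (ρ : V → ℝ) (hρ : ∀ e, ρ (src e) < ρ (tgt e))
    (hS : ∀ e, tgt e ∉ S) (hF : IsLinking src tgt S K F) {L : I → List E} {v : I → V}
    (hL : ∀ i, IsTrack src tgt S (L i) (v i)) (hLF : ∀ i, ∀ e ∈ L i, e ∈ F)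
    (hv : ∀ u ∈ terminals src tgt F, ∃ i, v i = u) (e : E) (he : e ∈ F) : ∃ i, e ∈ L i := by
  induction e using (wellFounded_rank_gt fun e => ρ (src e)).induction with
  | _ e ih =>
    by_cases h : ∃ f ∈ F, src f = tgt e
    · obtain ⟨f, hf, h⟩ := h
      obtain ⟨i, hi⟩ := ih f (by rw [h]; exact hρ e) hf
      rcases (hL i).back f hi with h' | ⟨e', he', h'⟩
      · exact absurd (h ▸ h') (hS e)
      · exact ⟨i, hF.tgt_inj (hLF i e' he') he (h'.trans h) ▸ he'⟩
    · push Not at h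
      obtain ⟨i, hi⟩ := hv (tgt e) (mem_terminals.2 ⟨⟨e, he, rfl⟩, h⟩)
      obtain ⟨e', he', h'⟩ := (hL i).last
      exact ⟨i, hF.tgt_inj (hLF i e' he') he (h'.trans hi) ▸ he'⟩

end Decomposition

/-! ### Gradings, left parts and paths in networks -/

namespace Network

variable {n : ℕ}

/-- A grading of a network: a function on the vertices that increases along the edges, and is
constant on sources and on sinks. -/
structure Grading (N : Network n) where
  rank : N.V → ℝ
  height : ℝ
  height_pos : 0 < height
  nonneg : ∀ v, 0 ≤ rank v
  lt : ∀ e, rank (N.src e) < rank (N.tgt e)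
  rank_source : ∀ i, rank (N.source i) = 0
  rank_sink : ∀ i, rank (N.sink i) = height
  sink_injective : Function.Injective N.sink

theorem Grading.tgt_notMem_source {N : Network n} (g : N.Grading) (e : N.E) :
    N.tgt e ∉ Set.range N.source := by
  rintro ⟨i, hi⟩
  have h1 := g.lt e
  have h2 := g.nonneg (N.src e)
  rw [← hi, g.rank_source] at h1
  linarith

theorem Grading.sink_notMem_source {N : Network n} (g : N.Grading) (j : Fin n) :
    N.sink j ∉ Set.range N.source := by
  rintro ⟨i, hi⟩
  have h := g.rank_sink j
  rw [← hi, g.rank_source] at h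
  exact g.height_pos.ne h

theorem Grading.rank_concatRight {N M : Network n} (g : N.Grading) (h : M.Grading) (v : M.V) :
    Sum.elim g.rank (fun u : {u : M.V // u ∉ Set.range M.source} => g.height + h.rank u)
      (concatRight N M v) = g.height + h.rank v := by
  unfold concatRight
  split_ifs with hv
  · obtain ⟨i, rfl⟩ := hv
    simp [g.rank_sink, h.rank_source]
  · rfl

/-- The grading of a concatenation. -/
def Grading.concat {N M : Network n} (g : N.Grading) (h : M.Grading) :
    (N.concat M).Grading where
  rank := Sum.elim g.rank fun u => g.height + h.rank u
  height := g.height + h.height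
  height_pos := add_pos g.height_pos h.height_pos
  nonneg := by
    rintro (v | v)
    · exact g.nonneg v
    · exact add_nonneg g.height_pos.le (h.nonneg v)
  lt := by
    rintro (e | e)
    · exact g.lt e
    · have := h.lt e
      simp only [Network.concat, Sum.elim_inr, g.rank_concatRight h]
      linarith
  rank_source i := g.rank_source i
  rank_sink i := by
    simp only [Network.concat, g.rank_concatRight h, h.rank_sink]
  sink_injective := by
    intro i j hij
    simp only [Network.concat, concatRight, dif_neg (h.sink_notMem_source _)] at hij
    exact h.sink_injective (congrArg Subtype.val (Sum.inr_injective hij))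

/-- An embedding of `N` as a part of `G` that contains the sources and that is not entered by
edges from outside. -/
structure LeftPart (N G : Network n) where
  vmap : N.V → G.V
  emap : N.E → G.E
  vmap_injective : Function.Injective vmap
  emap_injective : Function.Injective emap
  src_emap : ∀ e, G.src (emap e) = vmap (N.src e)
  tgt_emap : ∀ e, G.tgt (emap e) = vmap (N.tgt e)
  vmap_source : ∀ i, vmap (N.source i) = G.source i
  exists_emap_eq : ∀ e v, G.tgt e = vmap v → ∃ e', emap e' = e

def LeftPart.refl (N : Network n) : LeftPart N N where
  vmap := id
  emap := id
  vmap_injective := Function.injective_id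
  emap_injective := Function.injective_id
  src_emap _ := rfl
  tgt_emap _ := rfl
  vmap_source _ := rfl
  exists_emap_eq e _ _ := ⟨e, rfl⟩

def LeftPart.trans {N M G : Network n} (φ : LeftPart N M) (ψ : LeftPart M G) : LeftPart N G where
  vmap := ψ.vmap ∘ φ.vmap
  emap := ψ.emap ∘ φ.emap
  vmap_injective := ψ.vmap_injective.comp φ.vmap_injective
  emap_injective := ψ.emap_injective.comp φ.emap_injective
  src_emap e := by simp [ψ.src_emap, φ.src_emap]
  tgt_emap e := by simp [ψ.tgt_emap, φ.tgt_emap]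
  vmap_source i := by simp [ψ.vmap_source, φ.vmap_source]
  exists_emap_eq e v h := by
    obtain ⟨f, rfl⟩ := ψ.exists_emap_eq e _ h
    rw [ψ.tgt_emap] at h
    obtain ⟨f', rfl⟩ := φ.exists_emap_eq f v (ψ.vmap_injective h)
    exact ⟨f', rfl⟩

/-- The left factor of a concatenation. -/
def LeftPart.concat (N : Network n) {M : Network n} (h : M.Grading) : LeftPart N (N.concat M) where
  vmap := N.inclLeft M
  emap := Sum.inl
  vmap_injective := Sum.inl_injective
  emap_injective := Sum.inl_injective
  src_emap _ := rfl
  tgt_emap _ := rfl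
  vmap_source _ := rfl
  -- The target of an edge of `M` has positive rank, so it is not a source of `M` and is not glued
  -- to a vertex of `N`.
  exists_emap_eq := by
    rintro (e | e) v hv
    · exact ⟨e, rfl⟩
    · simp only [Network.concat, inclLeft, Sum.elim_inr, concatRight,
        dif_neg (h.tgt_notMem_source e)] at hv
      exact absurd hv Sum.inr_ne_inl

theorem edgeVerts_map {N G : Network n} (φ : LeftPart N G) (l : List N.E) :
    edgeVerts G.src G.tgt (l.map φ.emap) = φ.vmap '' edgeVerts N.src N.tgt l := by
  ext u
  simp only [edgeVerts, Set.mem_ofPred_eq, Set.mem_image, List.mem_map]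
  constructor
  · rintro ⟨_, ⟨e, he, rfl⟩, rfl | rfl⟩
    · exact ⟨_, ⟨e, he, .inl rfl⟩, (φ.src_emap e).symm⟩
    · exact ⟨_, ⟨e, he, .inr rfl⟩, (φ.tgt_emap e).symm⟩
  · rintro ⟨_, ⟨e, he, rfl | rfl⟩, rfl⟩
    · exact ⟨_, ⟨e, he, rfl⟩, .inl (φ.src_emap e).symm⟩
    · exact ⟨_, ⟨e, he, rfl⟩, .inr (φ.tgt_emap e).symm⟩

theorem _root_.IsTrack.map {N G : Network n} (φ : LeftPart N G) {l : List N.E} {v : N.V}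
    (h : IsTrack N.src N.tgt (Set.range N.source) l v) :
    IsTrack G.src G.tgt (Set.range G.source) (l.map φ.emap) (φ.vmap v) where
  nodup := h.nodup.map φ.emap_injective
  src_inj := by
    simp only [List.mem_map]
    rintro _ ⟨e, he, rfl⟩ _ ⟨f, hf, rfl⟩ hef
    rw [φ.src_emap, φ.src_emap] at hef
    rw [h.src_inj e he f hf (φ.vmap_injective hef)]
  tgt_inj := by
    simp only [List.mem_map]
    rintro _ ⟨e, he, rfl⟩ _ ⟨f, hf, rfl⟩ hef
    rw [φ.tgt_emap, φ.tgt_emap] at hef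
    rw [h.tgt_inj e he f hf (φ.vmap_injective hef)]
  back := by
    simp only [List.mem_map]
    rintro _ ⟨e, he, rfl⟩
    rcases h.back e he with ⟨i, hi⟩ | ⟨f, hf, hfe⟩
    · exact .inl ⟨i, by rw [φ.src_emap, ← hi, φ.vmap_source]⟩
    · exact .inr ⟨_, ⟨f, hf, rfl⟩, by rw [φ.src_emap, φ.tgt_emap, hfe]⟩
  fwd := by
    simp only [List.mem_map]
    rintro _ ⟨e, he, rfl⟩
    rcases h.fwd e he with hv | ⟨f, hf, hfe⟩
    · exact .inl (by rw [φ.tgt_emap, hv])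
    · exact .inr ⟨_, ⟨f, hf, rfl⟩, by rw [φ.src_emap, φ.tgt_emap, hfe]⟩
  last := by
    obtain ⟨e, he, hv⟩ := h.last
    exact ⟨_, List.mem_map.2 ⟨e, he, rfl⟩, by rw [φ.tgt_emap, hv]⟩
  final := by
    simp only [List.mem_map]
    rintro _ ⟨e, he, rfl⟩ hv
    rw [φ.src_emap] at hv
    exact h.final e he (φ.vmap_injective hv)

theorem Grading.pairwise_of_isChain {N : Network n} (g : N.Grading) {l : List N.E}
    (h : l.IsChain fun e f => N.tgt e = N.src f) :
    l.Pairwise fun e f => g.rank (N.tgt e) ≤ g.rank (N.src f) := by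
  have : IsTrans N.E fun e f => g.rank (N.tgt e) ≤ g.rank (N.src f) :=
    ⟨fun a b c h1 h2 => h1.trans ((g.lt b).le.trans h2)⟩
  exact (h.imp fun e f hef => (congrArg g.rank hef).le).pairwise

theorem mem_head?_or_exists_of_isChain {N : Network n} {l : List N.E}
    (h : l.IsChain fun e f => N.tgt e = N.src f) (e : N.E) (he : e ∈ l) :
    e ∈ l.head? ∨ ∃ f ∈ l, N.tgt f = N.src e := by
  obtain ⟨l₁, l₂, rfl⟩ := List.append_of_mem he
  rcases l₁.eq_nil_or_concat with rfl | ⟨l₁, f, rfl⟩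
  · exact .inl (by simp)
  · refine .inr ⟨f, by simp, ?_⟩
    exact (List.isChain_append.1 h).2.2 f (by simp) e (by simp)

theorem mem_getLast?_or_exists_of_isChain {N : Network n} {l : List N.E}
    (h : l.IsChain fun e f => N.tgt e = N.src f) (e : N.E) (he : e ∈ l) :
    e ∈ l.getLast? ∨ ∃ f ∈ l, N.src f = N.tgt e := by
  obtain ⟨l₁, l₂, rfl⟩ := List.append_of_mem he
  rcases l₂ with _ | ⟨f, l₂⟩
  · exact .inl (by simp)
  · refine .inr ⟨f, by simp, ?_⟩
    exact ((List.isChain_cons_cons.1 (List.isChain_append.1 h).2.1).1).symm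

/-- Ranks increase strictly along the path, so sources of distinct edges differ, as do targets, and
the final sink is not left again. -/
theorem IsPath.isTrack {N : Network n} (g : N.Grading) {l : List N.E} {i j : Fin n}
    (h : N.IsPath l i j) : IsTrack N.src N.tgt (Set.range N.source) l (N.sink j) := by
  have hp := g.pairwise_of_isChain h.chain
  have hne : l.Pairwise fun e f => N.src e ≠ N.src f ∧ N.tgt e ≠ N.tgt f := by
    refine hp.imp fun {e f} hef => ⟨fun h' => ?_, fun h' => ?_⟩
    · have := g.lt e
      rw [h'] at this
      linarith
    · have := g.lt f
      rw [← h'] at this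
      linarith
  have hne' : ∀ e ∈ l, ∀ f ∈ l, e ≠ f → N.src e ≠ N.src f ∧ N.tgt e ≠ N.tgt f := by
    intro e he f hf hef
    have : Std.Symm fun e f => N.src e ≠ N.src f ∧ N.tgt e ≠ N.tgt f :=
      ⟨fun _ _ h => ⟨h.1.symm, h.2.symm⟩⟩
    exact hne.forall he hf hef
  obtain ⟨e₀, he₀, hs⟩ := h.first
  obtain ⟨e₁, he₁, ht⟩ := h.last
  refine ⟨List.Nodup.of_map _ (List.nodup_cons.1 h.nodup).2, ?_, ?_, ?_, ?_, ?_, ?_⟩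
  · intro e he f hf hef
    by_contra hc
    exact (hne' e he f hf hc).1 hef
  · intro e he f hf hef
    by_contra hc
    exact (hne' e he f hf hc).2 hef
  · intro e he
    rcases mem_head?_or_exists_of_isChain h.chain e he with h' | h'
    · exact .inl ⟨i, by rw [← hs, Option.mem_unique h' he₀]⟩
    · exact .inr h'
  · intro e he
    rcases mem_getLast?_or_exists_of_isChain h.chain e he with h' | h'
    · exact .inl (by rw [← ht, Option.mem_unique h' he₁])
    · exact .inr h'
  · exact ⟨e₁, List.mem_of_mem_getLast? he₁, ht⟩
  · intro e he hc
    obtain ⟨l', rfl⟩ := List.getLast?_eq_some_iff.1 he₁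
    have h1 : g.rank (N.src e) ≤ g.rank (N.src e₁) := by
      rcases List.mem_append.1 he with h' | h'
      · exact (g.lt e).le.trans ((List.pairwise_append.1 hp).2.2 e h' e₁ (by simp))
      · rw [List.mem_singleton.1 h']
    have h2 := g.lt e₁
    rw [hc, ← ht] at h1
    linarith

/-- In a set of edges that is closed under predecessors, every edge to a sink ends a path. -/
theorem exists_isPath {N : Network n} (g : N.Grading) (F : Set N.E)
    (hF : ∀ e ∈ F, N.src e ∈ Set.range N.source ∨ ∃ f ∈ F, N.tgt f = N.src e)
    (e : N.E) (he : e ∈ F) (j : Fin n) (hj : N.tgt e = N.sink j) :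
    ∃ l i, N.IsPath l i j ∧ ∀ f ∈ l, f ∈ F := by
  -- The path is built backwards through predecessors; the rank of the target drops until a source
  -- is reached.
  have key : ∀ e ∈ F, ∃ (l : List N.E) (i : Fin n),
      (l ++ [e]).IsChain (fun e f => N.tgt e = N.src f) ∧
      (∃ f ∈ (l ++ [e]).head?, N.src f = N.source i) ∧ ∀ f ∈ l ++ [e], f ∈ F := by
    intro e
    induction e using (wellFounded_rank_lt fun e => g.rank (N.tgt e)).induction with
    | _ e ih =>
      intro he
      rcases hF e he with ⟨i, hi⟩ | ⟨f, hf, hfe⟩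
      · exact ⟨[], i, by simp, ⟨e, by simp, hi.symm⟩, by simpa using he⟩
      · obtain ⟨l, i, h1, ⟨f', h2, h3⟩, h4⟩ := ih f (by rw [hfe]; exact g.lt e) hf
        refine ⟨l ++ [f], i, ?_, ⟨f', ?_, h3⟩, ?_⟩
        · refine List.isChain_append.2 ⟨h1, by simp, ?_⟩
          intro x hx y hy
          simp only [List.getLast?_append, List.getLast?_singleton, Option.some_or,
            Option.mem_def, Option.some.injEq, List.head?_cons] at hx hy
          rw [← hx, ← hy, hfe]
        · rw [List.head?_append]
          rw [Option.mem_def] at h2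
          rw [h2]
          rfl
        · intro x hx
          rcases List.mem_append.1 hx with h | h
          · exact h4 x h
          · rwa [List.mem_singleton.1 h]
  obtain ⟨l, i, h1, h2, h3⟩ := key e he
  refine ⟨l ++ [e], i, ⟨h1, h2, ⟨e, by simp, hj⟩, ?_⟩, h3⟩
  refine List.nodup_cons.2 ⟨?_, ?_⟩
  · rw [List.mem_map]
    rintro ⟨f, _, hf⟩
    exact g.tgt_notMem_source f ⟨i, hf.symm⟩
  · refine (List.pairwise_map).2 ((g.pairwise_of_isChain h1).imp fun {a b} hab hc => ?_)
    have := g.lt b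
    rw [← hc] at this
    linarith

end Network

/-! ### Multipaths in several left parts and linkings -/

namespace Network

variable {n : ℕ}

/-- A family of left parts of `G` with compatible gradings, and a colouring of the vertices of `G`
that separates the sinks of different left parts. -/
structure Levels {C : Type} (N : C → Network n) (G : Network n) where
  leftPart : ∀ c, LeftPart (N c) G
  grading : ∀ c, (N c).Grading
  top : G.Grading
  rank_vmap : ∀ c v, top.rank ((leftPart c).vmap v) = (grading c).rank v
  level : G.V → C
  level_sink : ∀ c j, level ((leftPart c).vmap ((N c).sink j)) = c

namespace Levels

variable {C : Type} {N : C → Network n} {G : Network n} (Λ : Levels N G)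

/-- The sinks of all left parts, as vertices of `G`. -/
def sinks : Set G.V := {v | ∃ c j, (Λ.leftPart c).vmap ((N c).sink j) = v}

theorem disjoint_sinks : Disjoint (Set.range G.source) Λ.sinks := by
  rw [Set.disjoint_left]
  rintro _ ⟨i, rfl⟩ ⟨c, j, h⟩
  have h1 := Λ.rank_vmap c ((N c).sink j)
  rw [h, Λ.top.rank_source, (Λ.grading c).rank_sink] at h1
  exact (Λ.grading c).height_pos.ne h1

/-- The multipaths in the left parts are pairwise disjoint in `G`. -/
def IsDisjoint {t : C → ℕ} (P : ∀ c, (N c).Multipath (t c)) : Prop :=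
  ∀ c c', c ≠ c' → Disjoint ((Λ.leftPart c).vmap '' (P c).verts)
    ((Λ.leftPart c').vmap '' (P c').verts)

/-- The edges of all the paths, moved into `G`, form the linking: disjointness makes the ends
distinct, and the level of an end tells which left part its path came from. -/
theorem exists_linking_of_multipaths [Fintype C] [DecidableEq C] [DecidableEq G.V] {t : C → ℕ}
    (P : ∀ c, (N c).Multipath (t c)) (hP : Λ.IsDisjoint P) (w : G.E → TropNum) :
    ∃ F : Finset G.E, IsLinking G.src G.tgt (Set.range G.source) Λ.sinks F ∧
      (∀ c, ((terminals G.src G.tgt F).filter (Λ.level · = c)).card = t c) ∧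
      ∑ e ∈ F, w e = ∑ c, (P c).weight (w ∘ (Λ.leftPart c).emap) := by
  classical
  let I := Σ c, {p // p ∈ (P c).1}
  let L : I → List G.E := fun x => x.2.1.1.map (Λ.leftPart x.1).emap
  let j : I → Fin n := fun x => x.2.1.2.choose_spec.choose
  have hj : ∀ x : I, ∃ i, (N x.1).IsPath x.2.1.1 i (j x) := fun x =>
    ⟨_, x.2.1.2.choose_spec.choose_spec⟩
  let v : I → G.V := fun x => (Λ.leftPart x.1).vmap ((N x.1).sink (j x))
  have hL : ∀ x, IsTrack G.src G.tgt (Set.range G.source) (L x) (v x) := by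
    intro x
    obtain ⟨i, hi⟩ := hj x
    exact (hi.isTrack (Λ.grading x.1)).map (Λ.leftPart x.1)
  have hd : ∀ x y, x ≠ y →
      Disjoint (edgeVerts G.src G.tgt (L x)) (edgeVerts G.src G.tgt (L y)) := by
    rintro ⟨c, p, hp⟩ ⟨c', p', hp'⟩ hne
    simp only [L, edgeVerts_map]
    by_cases hc : c = c'
    · subst hc
      rw [Set.disjoint_image_iff (Λ.leftPart c).vmap_injective]
      refine (P c).2.2 p hp p' hp' ?_
      rintro rfl
      exact hne rfl
    · refine (hP c c' hc).mono (Set.image_mono ?_) (Set.image_mono ?_)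
      · exact fun u hu => ⟨p, hp, hu⟩
      · exact fun u hu => ⟨p', hp', hu⟩
  refine ⟨edgeUnion L, isLinking_edgeUnion hL hd fun x => ⟨_, _, rfl⟩, ?_, ?_⟩
  · intro c
    rw [terminals_edgeUnion hL hd, Finset.filter_image,
      Finset.card_image_of_injective _ (end_injective hL hd), ← (P c).2.1]
    simp only [v, Λ.level_sink]
    rw [← Finset.card_attach (s := (P c).1)]
    refine (Finset.card_bij (fun p _ => (⟨c, p⟩ : I)) ?_ ?_ ?_).symm
    · intro p _
      exact Finset.mem_filter.2 ⟨Finset.mem_univ _, rfl⟩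
    · intro p _ q _ h
      exact eq_of_heq (Sigma.mk.inj h).2
    · rintro ⟨c', p⟩ hx
      obtain rfl : c' = c := (Finset.mem_filter.1 hx).2
      exact ⟨p, Finset.mem_attach _ _, rfl⟩
  · rw [sum_edgeUnion (fun x => (hL x).nodup) hd, Fintype.sum_sigma]
    refine Finset.sum_congr rfl fun c _ => ?_
    rw [Multipath.weight, ← Finset.sum_coe_sort (P c).1]
    refine Finset.sum_congr rfl fun p _ => ?_
    simp [L, Path.weight]

/-- Each terminal of level `c` is a sink of `N c`. Since `N c` is not entered from outside, the path
traced back from it inside `F` stays in `N c`. -/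
theorem exists_multipaths_of_linking [Fintype C] [DecidableEq C] [DecidableEq G.V] {t : C → ℕ}
    {F : Finset G.E} (hF : IsLinking G.src G.tgt (Set.range G.source) Λ.sinks F)
    (ht : ∀ c, ((terminals G.src G.tgt F).filter (Λ.level · = c)).card = t c)
    (w : G.E → TropNum) :
    ∃ P : ∀ c, (N c).Multipath (t c), Λ.IsDisjoint P ∧
      ∑ e ∈ F, w e = ∑ c, (P c).weight (w ∘ (Λ.leftPart c).emap) := by
  classical
  let J : C → Type := fun c =>
    {j : Fin n // (Λ.leftPart c).vmap ((N c).sink j) ∈ terminals G.src G.tgt F}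
  have path : ∀ c (j : J c), ∃ p : (N c).Path,
      (∃ i, (N c).IsPath p.1 i j.1) ∧ ∀ e ∈ p.1, (Λ.leftPart c).emap e ∈ F := by
    rintro c ⟨j, hj⟩
    obtain ⟨⟨e, he, hej⟩, -⟩ := mem_terminals.1 hj
    obtain ⟨e, rfl⟩ := (Λ.leftPart c).exists_emap_eq e _ hej
    rw [(Λ.leftPart c).tgt_emap] at hej
    obtain ⟨l, i, hl, hlF⟩ := exists_isPath (Λ.grading c) {e | (Λ.leftPart c).emap e ∈ F} (by
      intro e he
      rcases hF.src_mem _ he with ⟨i, hi⟩ | ⟨f, hf, hfe⟩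
      · rw [(Λ.leftPart c).src_emap, ← (Λ.leftPart c).vmap_source] at hi
        exact .inl ⟨i, (Λ.leftPart c).vmap_injective hi⟩
      · rw [(Λ.leftPart c).src_emap] at hfe
        obtain ⟨f, rfl⟩ := (Λ.leftPart c).exists_emap_eq f _ hfe
        rw [(Λ.leftPart c).tgt_emap] at hfe
        exact .inr ⟨f, hf, (Λ.leftPart c).vmap_injective hfe⟩) e he j
      ((Λ.leftPart c).vmap_injective hej)
    exact ⟨⟨l, i, j, hl⟩, ⟨i, hl⟩, hlF⟩
  choose p hp hpF using path
  let I := Σ c, J c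
  let L : I → List G.E := fun x => (p x.1 x.2).1.map (Λ.leftPart x.1).emap
  let v : I → G.V := fun x => (Λ.leftPart x.1).vmap ((N x.1).sink x.2.1)
  have hL : ∀ x, IsTrack G.src G.tgt (Set.range G.source) (L x) (v x) := by
    intro x
    obtain ⟨i, hi⟩ := hp x.1 x.2
    exact (hi.isTrack (Λ.grading x.1)).map (Λ.leftPart x.1)
  have hLF : ∀ x, ∀ e ∈ L x, e ∈ F := by
    intro x e he
    obtain ⟨e', he', rfl⟩ := List.mem_map.1 he
    exact hpF _ _ e' he'
  have hv : Function.Injective v := by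
    rintro ⟨c, j, hj⟩ ⟨c', j', hj'⟩ h
    have hc : c = c' := by
      rw [← Λ.level_sink c j, ← Λ.level_sink c' j']
      exact congrArg Λ.level h
    subst hc
    obtain rfl : j = j' := (Λ.grading c).sink_injective ((Λ.leftPart c).vmap_injective h)
    rfl
  have hd : ∀ x y, x ≠ y →
      Disjoint (edgeVerts G.src G.tgt (L x)) (edgeVerts G.src G.tgt (L y)) := fun x y hxy =>
    disjoint_edgeVerts_of_end_ne Λ.top.rank Λ.top.lt Λ.top.tgt_notMem_source hF (hL x) (hL y)
      (hLF x) (hLF y) x.2.2 y.2.2 (hv.ne hxy)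
  have hd' : ∀ c c' (j : J c) (j' : J c'), (⟨c, j⟩ : I) ≠ ⟨c', j'⟩ →
      Disjoint ((Λ.leftPart c).vmap '' (p c j).verts)
        ((Λ.leftPart c').vmap '' (p c' j').verts) := by
    intro c c' j j' hne
    have := hd ⟨c, j⟩ ⟨c', j'⟩ hne
    simp only [L, edgeVerts_map] at this
    exact this
  -- Tracks with different ends are disjoint and nonempty, so different terminals give different
  -- paths and the number of paths is right.
  have hpinj : ∀ c, Function.Injective (p c) := by
    intro c j j' h
    by_contra hne
    have h1 := hd ⟨c, j⟩ ⟨c, j'⟩ (fun h => hne (sigma_mk_injective h))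
    simp only [L, h, disjoint_self] at h1
    obtain ⟨e, he, -⟩ := (hL ⟨c, j'⟩).last
    exact (Set.eq_empty_iff_forall_notMem.1 h1) _ (src_mem_edgeVerts he)
  have hcard : ∀ c, Fintype.card (J c) = t c := by
    intro c
    rw [← ht c, ← Finset.card_univ]
    refine Finset.card_bij (fun j _ => v ⟨c, j⟩) ?_ ?_ ?_
    · intro j _
      exact Finset.mem_filter.2 ⟨j.2, Λ.level_sink _ _⟩
    · intro j _ j' _ h
      exact sigma_mk_injective (hv h)
    · intro u hu
      obtain ⟨hu', hc⟩ := Finset.mem_filter.1 hu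
      obtain ⟨c', j, rfl⟩ := hF.terminals_subset hu'
      rw [Λ.level_sink] at hc
      subst hc
      exact ⟨⟨j, hu'⟩, Finset.mem_univ _, rfl⟩
  refine ⟨fun c => ⟨Finset.univ.map ⟨p c, hpinj c⟩, ?_, ?_⟩, ?_, ?_⟩
  · rw [Finset.card_map, Finset.card_univ, hcard]
  · intro q hq q' hq' hne
    obtain ⟨j, -, rfl⟩ := Finset.mem_map.1 hq
    obtain ⟨j', -, rfl⟩ := Finset.mem_map.1 hq'
    refine (Set.disjoint_image_iff (Λ.leftPart c).vmap_injective).1 (hd' c c j j' ?_)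
    intro h
    obtain rfl : j = j' := sigma_mk_injective h
    exact hne rfl
  · intro c c' hc
    rw [Set.disjoint_left]
    rintro _ ⟨u, ⟨q, hq, hu⟩, rfl⟩ ⟨u', ⟨q', hq', hu'⟩, h⟩
    obtain ⟨j, -, rfl⟩ := Finset.mem_map.1 hq
    obtain ⟨j', -, rfl⟩ := Finset.mem_map.1 hq'
    refine Set.disjoint_left.1 (hd' c c' j j' ?_) ⟨u, hu, rfl⟩ ⟨u', hu', h⟩
    intro h
    exact hc (congrArg Sigma.fst h)
  -- The traced paths exhaust `F`, so no weight is lost.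
  · have hFL : F = edgeUnion L := by
      ext e
      rw [mem_edgeUnion]
      refine ⟨fun he => ?_, fun ⟨x, hx⟩ => hLF x e hx⟩
      refine exists_track_mem Λ.top.rank Λ.top.lt Λ.top.tgt_notMem_source hF hL hLF ?_ e he
      intro u hu
      obtain ⟨c, j, rfl⟩ := hF.terminals_subset hu
      exact ⟨⟨c, j, hu⟩, rfl⟩
    refine (congrArg (fun A : Finset G.E => ∑ e ∈ A, w e) hFL).trans ?_
    rw [sum_edgeUnion (fun x => (hL x).nodup) hd, Fintype.sum_sigma]
    refine Finset.sum_congr rfl fun c _ => ?_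
    refine Eq.trans ?_ (Finset.sum_map _ _ _).symm
    refine Finset.sum_congr rfl fun j _ => ?_
    simp [L, Path.weight]

end Levels

end Network

/-! ### The tower of concatenations and the exchange inequality -/

/-- The grading of a planar network by the abscissa. -/
def PlanarNetwork.grading {n : ℕ} (A : PlanarNetwork n) : A.toNetwork.Grading where
  rank := A.x
  height := A.r
  height_pos := A.r_pos
  nonneg v := (A.x_mem v).1
  lt := A.left_to_right
  rank_source i := (A.source_iff _).2 ⟨i, rfl⟩
  rank_sink i := (A.sink_iff _).2 ⟨i, rfl⟩
  sink_injective _ _ h := A.sink_mono.injective (congrArg A.y h)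

namespace Network

variable {n : ℕ}

/-- The networks `A`, `A ∘ B`, `A ∘ B ∘ C`. -/
noncomputable def tower (A B C : Network n) : Fin 3 → Network n
  | 0 => A
  | 1 => A.concat B
  | 2 => (A.concat B).concat C

variable {A B C : Network n}

open Classical in
/-- The networks `A`, `A ∘ B`, `A ∘ B ∘ C` as left parts of the last one. -/
noncomputable def towerLevels (g : A.Grading) (h : B.Grading) (k : C.Grading) :
    Levels (tower A B C) ((A.concat B).concat C) where
  leftPart
    | 0 => (LeftPart.concat A h).trans (LeftPart.concat (A.concat B) k)
    | 1 => LeftPart.concat (A.concat B) k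
    | 2 => LeftPart.refl _
  grading
    | 0 => g
    | 1 => g.concat h
    | 2 => (g.concat h).concat k
  top := (g.concat h).concat k
  rank_vmap
    | 0, _ => rfl
    | 1, _ => rfl
    | 2, _ => rfl
  -- The sinks of the three networks lie at three different heights, as every factor has positive
  -- height; the rank thus determines the level.
  level v := if ((g.concat h).concat k).rank v = g.height then 0
    else if ((g.concat h).concat k).rank v = (g.concat h).height then 1 else 2
  level_sink
    | 0, j => if_pos (g.rank_sink j)
    | 1, j => by
      have e : ((g.concat h).concat k).rank ((LeftPart.concat (A.concat B) k).vmap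
          ((A.concat B).sink j)) = (g.concat h).height := (g.concat h).rank_sink j
      have hh := h.height_pos
      have e' : (g.concat h).height = g.height + h.height := rfl
      refine (if_neg ?_).trans (if_pos e)
      intro hc
      have := e.symm.trans hc
      linarith
    | 2, j => by
      have e := ((g.concat h).concat k).rank_sink j
      have hh := h.height_pos
      have hk := k.height_pos
      have e' : (g.concat h).height = g.height + h.height := rfl
      have e'' : ((g.concat h).concat k).height = g.height + h.height + k.height := rfl
      refine (if_neg ?_).trans (if_neg ?_)
      · intro hc
        have := e.symm.trans hc
        linarith
      · intro hc
        have := e.symm.trans hc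
        linarith

/-- The three multipaths of an `(a, b, c)`-multipath. -/
def MultiMultipath.family {t : Fin 3 → ℕ} (P : MultiMultipath A B C (t 0) (t 1) (t 2)) :
    ∀ c, (tower A B C c).Multipath (t c)
  | 0 => P.p₁
  | 1 => P.p₂
  | 2 => P.p₃

theorem MultiMultipath.isDisjoint_family (g : A.Grading) (h : B.Grading) (k : C.Grading)
    {t : Fin 3 → ℕ} (P : MultiMultipath A B C (t 0) (t 1) (t 2)) :
    (towerLevels g h k).IsDisjoint P.family := by
  have h₁₂ : Disjoint ((A.concat B).inclLeft C ∘ A.inclLeft B '' P.p₁.verts)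
      ((A.concat B).inclLeft C '' P.p₂.verts) := by
    rw [Set.image_comp]
    exact (Set.disjoint_image_iff Sum.inl_injective).2 P.disj₁₂
  have h₁₃ : Disjoint ((A.concat B).inclLeft C ∘ A.inclLeft B '' P.p₁.verts)
      (id '' P.p₃.verts) := by
    rw [Set.image_comp, Set.image_id]
    exact P.disj₁₃
  have h₂₃ : Disjoint ((A.concat B).inclLeft C '' P.p₂.verts) (id '' P.p₃.verts) := by
    rw [Set.image_id]
    exact P.disj₂₃
  intro c c' hc
  match c, c', hc with
  | 0, 0, hc => exact absurd rfl hc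
  | 0, 1, _ => exact h₁₂
  | 0, 2, _ => exact h₁₃
  | 1, 0, _ => exact h₁₂.symm
  | 1, 1, hc => exact absurd rfl hc
  | 1, 2, _ => exact h₂₃
  | 2, 0, _ => exact h₁₃.symm
  | 2, 1, _ => exact h₂₃.symm
  | 2, 2, hc => exact absurd rfl hc

/-- An `(a, b, c)`-multipath from its three multipaths. -/
noncomputable def MultiMultipath.ofFamily (g : A.Grading) (h : B.Grading) (k : C.Grading)
    {t : Fin 3 → ℕ} (P : ∀ c, (tower A B C c).Multipath (t c))
    (hP : (towerLevels g h k).IsDisjoint P) : MultiMultipath A B C (t 0) (t 1) (t 2) where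
  p₁ := P 0
  p₂ := P 1
  p₃ := P 2
  disj₁₂ := by
    have aux : ∀ (X : Set A.V) (Y : Set (A.concat B).V),
        Disjoint ((A.concat B).inclLeft C ∘ A.inclLeft B '' X) ((A.concat B).inclLeft C '' Y) →
          Disjoint (A.inclLeft B '' X) Y := by
      intro X Y hXY
      rw [Set.image_comp] at hXY
      exact (Set.disjoint_image_iff Sum.inl_injective).1 hXY
    exact aux _ _ (hP 0 1 (by decide))
  disj₁₃ := by
    have aux : ∀ (X : Set A.V) (Y : Set ((A.concat B).concat C).V),
        Disjoint ((A.concat B).inclLeft C ∘ A.inclLeft B '' X) (id '' Y) →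
          Disjoint ((A.concat B).inclLeft C '' (A.inclLeft B '' X)) Y := by
      intro X Y hXY
      rwa [Set.image_comp, Set.image_id] at hXY
    exact aux _ _ (hP 0 2 (by decide))
  disj₂₃ := by
    have aux : ∀ (X : Set (A.concat B).V) (Y : Set ((A.concat B).concat C).V),
        Disjoint ((A.concat B).inclLeft C '' X) (id '' Y) →
          Disjoint ((A.concat B).inclLeft C '' X) Y := by
      intro X Y hXY
      rwa [Set.image_id] at hXY
    exact aux _ _ (hP 1 2 (by decide))

/-- The maximal weight of an `(a, b, c)`-multipath. -/
noncomputable def maxMultipathWeight (w₁ : A.E → TropNum) (w₂ : B.E → TropNum)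
    (w₃ : C.E → TropNum) (a b c : ℕ) : TropNum :=
  Finset.univ.sup fun P : MultiMultipath A B C a b c => P.weight w₁ w₂ w₃

/-- The exchange inequality for the maximal weights of multipaths. -/
theorem maxMultipathWeight_add_le (g : A.Grading) (h : B.Grading) (k : C.Grading)
    (w₁ : A.E → TropNum) (w₂ : B.E → TropNum) (w₃ : C.E → TropNum) (m : (Fin 3 → ℕ) → TropNum)
    (hm : ∀ t, m t = maxMultipathWeight w₁ w₂ w₃ (t 0) (t 1) (t 2))
    (t : Fin 3 → ℕ) (p q s : Fin 3) (hpq : p ≠ q) (hps : p ≠ s) (hqs : q ≠ s) :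
    m (fun c => t c + if c = s then 1 else 0) +
        m (fun c => t c + ((if c = p then 1 else 0) + if c = q then 1 else 0)) ≤
      max (m (fun c => t c + if c = p then 1 else 0) +
          m (fun c => t c + ((if c = q then 1 else 0) + if c = s then 1 else 0)))
        (m (fun c => t c + ((if c = p then 1 else 0) + if c = s then 1 else 0)) +
          m (fun c => t c + if c = q then 1 else 0)) := by
  classical
  have : Fintype ((A.concat B).concat C).V := Fintype.ofFinite _
  let Λ := towerLevels g h k
  let w := concatWeight (concatWeight w₁ w₂) w₃
  have toLinking : ∀ u : Fin 3 → ℕ, m u ≠ ⊥ → ∃ F : Finset ((A.concat B).concat C).E,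
      IsLinking ((A.concat B).concat C).src ((A.concat B).concat C).tgt
        (Set.range ((A.concat B).concat C).source) Λ.sinks F ∧
      (∀ c, ((terminals ((A.concat B).concat C).src ((A.concat B).concat C).tgt F).filter
        (Λ.level · = c)).card = u c) ∧ ∑ e ∈ F, w e = m u := by
    intro u hu
    have hne : (Finset.univ : Finset (MultiMultipath A B C (u 0) (u 1) (u 2))).Nonempty := by
      rw [Finset.nonempty_iff_ne_empty]
      intro he
      rw [hm, maxMultipathWeight, he, Finset.sup_empty] at hu
      exact hu rfl
    obtain ⟨P, -, hP⟩ := Finset.exists_mem_eq_sup _ hne fun P => P.weight w₁ w₂ w₃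
    obtain ⟨F, h1, h2, h3⟩ :=
      Λ.exists_linking_of_multipaths P.family (P.isDisjoint_family g h k) w
    refine ⟨F, h1, h2, ?_⟩
    rw [h3, hm, maxMultipathWeight, hP, Fin.sum_univ_three]
    rfl
  have ofLinking : ∀ (u : Fin 3 → ℕ) (F : Finset ((A.concat B).concat C).E),
      IsLinking ((A.concat B).concat C).src ((A.concat B).concat C).tgt
        (Set.range ((A.concat B).concat C).source) Λ.sinks F →
      (∀ c, ((terminals ((A.concat B).concat C).src ((A.concat B).concat C).tgt F).filter
        (Λ.level · = c)).card = u c) → ∑ e ∈ F, w e ≤ m u := by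
    intro u F h1 h2
    obtain ⟨P, hP, h3⟩ := Λ.exists_multipaths_of_linking h1 h2 w
    rw [h3, hm, maxMultipathWeight, Fin.sum_univ_three]
    exact Finset.le_sup (f := fun P => MultiMultipath.weight w₁ w₂ w₃ P)
      (Finset.mem_univ (MultiMultipath.ofFamily g h k P hP))
  -- If either summand on the left is `⊥`, the inequality is trivial. Otherwise both maxima are
  -- attained, and the optimal linkings can be exchanged.
  by_cases h1 : m (fun c => t c + if c = s then 1 else 0) = ⊥
  · rw [h1, WithBot.bot_add]
    exact bot_le
  by_cases h2 : m (fun c => t c + ((if c = p then 1 else 0) + if c = q then 1 else 0)) = ⊥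
  · rw [h2, WithBot.add_bot]
    exact bot_le
  obtain ⟨F, hF, hFt, hFw⟩ := toLinking _ h1
  obtain ⟨G, hG, hGt, hGw⟩ := toLinking _ h2
  obtain ⟨F', G', hF', hG', hw, hc⟩ := exists_linking_exchange Λ.disjoint_sinks Λ.level hF hG t
    p q s hpq hps hqs hFt hGt w
  rw [← hFw, ← hGw, ← hw]
  rcases hc with hc | hc
  · exact le_max_of_le_left (add_le_add (ofLinking _ F' hF' fun c => (hc c).1)
      (ofLinking _ G' hG' fun c => (hc c).2))
  · exact le_max_of_le_right (add_le_add (ofLinking _ F' hF' fun c => (hc c).1)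
      (ofLinking _ G' hG' fun c => (hc c).2))

end Network

/-! ### Non-differentiability and the conclusion -/

theorem not_differentiableAt_of_eq_add_max {ι : Type*} [Fintype ι] [DecidableEq ι]
    (f : (ι → ℝ) → ℝ) (z : ι → ℝ) (p : ι)
    (hf : ∀ t : ℝ, f (z + t • Pi.single p 1) = f z + max t 0) : ¬ DifferentiableAt ℝ f z := by
  intro hd
  have hline : DifferentiableAt ℝ (fun t : ℝ => z + t • (Pi.single p 1 : ι → ℝ)) 0 := by
    fun_prop
  have hcomp : DifferentiableAt ℝ (fun t : ℝ => f (z + t • (Pi.single p 1 : ι → ℝ))) 0 :=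
    DifferentiableAt.comp (𝕜 := ℝ) (g := f) 0 (by simpa using hd) hline
  -- From `|t| = 2 max(t, 0) - t`, differentiability along the line would make the absolute value
  -- differentiable at 0.
  have habs : (fun t : ℝ => |t|) =
      fun t => 2 * (f (z + t • (Pi.single p 1 : ι → ℝ)) - f z) - t := by
    funext t
    rw [hf]
    rcases le_total t 0 with ht | ht
    · rw [max_eq_right ht, abs_of_nonpos ht]
      ring
    · rw [max_eq_left ht, abs_of_nonneg ht]
      ring
  refine not_differentiableAt_abs_zero ?_
  change DifferentiableAt ℝ (fun t : ℝ => |t|) 0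
  rw [habs]
  exact ((hcomp.sub_const _).const_mul 2).sub differentiableAt_id

namespace SmallTetrahedron

/-- Where none of the three sums exceeds the maximum of the other two, their maximum is not
differentiable. -/
theorem not_differentiableAt_maxFun {n : ℕ} (T : SmallTetrahedron n) (z : latticeSimplex n → ℝ)
    (ha : z T.a₁ + z T.a₂ ≤ max (z T.b₁ + z T.b₂) (z T.c₁ + z T.c₂))
    (hb : z T.b₁ + z T.b₂ ≤ max (z T.a₁ + z T.a₂) (z T.c₁ + z T.c₂))
    (hc : z T.c₁ + z T.c₂ ≤ max (z T.a₁ + z T.a₂) (z T.b₁ + z T.b₂)) :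
    ¬ DifferentiableAt ℝ T.maxFun z := by
  -- If the `a`-sum is at least one of the others, the hypotheses make it maximal and tied with
  -- another sum; raising the coordinate `a₁` then gives the kink. Otherwise the `b`- and `c`-sums
  -- tie strictly above it, and `b₁` is moved.
  by_cases h : z T.b₁ + z T.b₂ ≤ z T.a₁ + z T.a₂ ∨ z T.c₁ + z T.c₂ ≤ z T.a₁ + z T.a₂
  · have hmax : max (z T.b₁ + z T.b₂) (z T.c₁ + z T.c₂) = z T.a₁ + z T.a₂ := by
      refine le_antisymm (max_le ?_ ?_) ha <;> grind
    refine not_differentiableAt_of_eq_add_max _ _ T.a₁ fun t => ?_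
    have e : ∀ u, u ≠ T.a₁ → (z + t • (Pi.single T.a₁ 1 : latticeSimplex n → ℝ)) u = z u := by
      intro u hu
      simp [hu]
    have e₁ : (z + t • (Pi.single T.a₁ 1 : latticeSimplex n → ℝ)) T.a₁ = z T.a₁ + t := by simp
    rw [maxFun, maxFun, e₁, e T.a₂ (by simp [a₁, a₂]), e T.b₁ (by simp [a₁, b₁]),
      e T.b₂ (by simp [a₁, b₂]), e T.c₁ (by simp [a₁, c₁]), e T.c₂ (by simp [a₁, c₂]), hmax,
      max_self, ← max_add_add_left]
    congr 1 <;> ring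
  · push Not at h
    have hbc : z T.c₁ + z T.c₂ = z T.b₁ + z T.b₂ := by grind
    have hab : z T.a₁ + z T.a₂ ≤ z T.b₁ + z T.b₂ := h.1.le
    refine not_differentiableAt_of_eq_add_max _ _ T.b₁ fun t => ?_
    have e : ∀ u, u ≠ T.b₁ → (z + t • (Pi.single T.b₁ 1 : latticeSimplex n → ℝ)) u = z u := by
      intro u hu
      simp [hu]
    have e₁ : (z + t • (Pi.single T.b₁ 1 : latticeSimplex n → ℝ)) T.b₁ = z T.b₁ + t := by simp
    rw [maxFun, maxFun, e₁, e T.a₁ (by simp [a₁, b₁]), e T.a₂ (by simp [b₁, a₂]),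
      e T.b₂ (by simp [b₁, b₂]), e T.c₁ (by simp [b₁, c₁]), e T.c₂ (by simp [b₁, c₂]), hbc,
      max_self, max_eq_right hab, ← max_add_add_left, max_eq_right]
    · congr 1 <;> ring
    · exact hab.trans (by simp)

end SmallTetrahedron

theorem mainTheorem2 (n : ℕ) (A B C : PlanarNetwork n) (w₁ : A.E → TropNum)
    (w₂ : B.E → TropNum) (w₃ : C.E → TropNum) (μ : latticeSimplex n → TropNum)
    (hμ : μ = maxWeight A B C w₁ w₂ w₃) (T : SmallTetrahedron n) :
    -- each of the three sums is at most the maximum of the other two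
    (μ T.a₁ + μ T.a₂ ≤ max (μ T.b₁ + μ T.b₂) (μ T.c₁ + μ T.c₂) ∧
      μ T.b₁ + μ T.b₂ ≤ max (μ T.a₁ + μ T.a₂) (μ T.c₁ + μ T.c₂) ∧
      μ T.c₁ + μ T.c₂ ≤ max (μ T.a₁ + μ T.a₂) (μ T.b₁ + μ T.b₂)) ∧
    -- where the six values are real, `max {a₁ + a₂, b₁ + b₂, c₁ + c₂}` is not smooth there
    ∀ z : latticeSimplex n → ℝ,
      (∀ p, p = T.a₁ ∨ p = T.a₂ ∨ p = T.b₁ ∨ p = T.b₂ ∨ p = T.c₁ ∨ p = T.c₂ →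
        (z p : TropNum) = μ p) →
      ¬ DifferentiableAt ℝ T.maxFun z := by
  classical
  subst hμ
  let m : (Fin 3 → ℕ) → TropNum := fun t =>
    Network.maxMultipathWeight w₁ w₂ w₃ (t 0) (t 1) (t 2)
  have key := Network.maxMultipathWeight_add_le A.grading B.grading C.grading w₁ w₂ w₃ m
    (fun _ => rfl) ![T.i, T.j, T.k]
  have ha : maxWeight A B C w₁ w₂ w₃ T.a₁ + maxWeight A B C w₁ w₂ w₃ T.a₂ ≤
      max (maxWeight A B C w₁ w₂ w₃ T.b₁ + maxWeight A B C w₁ w₂ w₃ T.b₂)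
        (maxWeight A B C w₁ w₂ w₃ T.c₁ + maxWeight A B C w₁ w₂ w₃ T.c₂) := by
    rw [add_comm (maxWeight A B C w₁ w₂ w₃ T.c₁)]
    -- The last index `s` is the direction of the single step on the left, here `a₁ = t + e₁`, and
    -- the first two give `a₂ = t + e₀ + e₂`. The other two inequalities arise in the same way with
    -- `s = 0` and `s = 2`.
    exact key 0 2 1 (by decide) (by decide) (by decide)
  have hb : maxWeight A B C w₁ w₂ w₃ T.b₁ + maxWeight A B C w₁ w₂ w₃ T.b₂ ≤
      max (maxWeight A B C w₁ w₂ w₃ T.a₁ + maxWeight A B C w₁ w₂ w₃ T.a₂)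
        (maxWeight A B C w₁ w₂ w₃ T.c₁ + maxWeight A B C w₁ w₂ w₃ T.c₂) := by
    rw [add_comm (maxWeight A B C w₁ w₂ w₃ T.c₁)]
    exact key 1 2 0 (by decide) (by decide) (by decide)
  have hc : maxWeight A B C w₁ w₂ w₃ T.c₁ + maxWeight A B C w₁ w₂ w₃ T.c₂ ≤
      max (maxWeight A B C w₁ w₂ w₃ T.a₁ + maxWeight A B C w₁ w₂ w₃ T.a₂)
        (maxWeight A B C w₁ w₂ w₃ T.b₁ + maxWeight A B C w₁ w₂ w₃ T.b₂) := by
    rw [max_comm, add_comm (maxWeight A B C w₁ w₂ w₃ T.a₁)]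
    exact key 0 1 2 (by decide) (by decide) (by decide)
  refine ⟨⟨ha, hb, hc⟩, fun z hz => ?_⟩
  rw [← hz T.a₁ (by simp), ← hz T.a₂ (by simp), ← hz T.b₁ (by simp), ← hz T.b₂ (by simp),
    ← hz T.c₁ (by simp), ← hz T.c₂ (by simp)] at ha hb hc
  exact T.not_differentiableAt_maxFun z (by exact_mod_cast ha) (by exact_mod_cast hb)
    (by exact_mod_cast hc)
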